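/- Let $G$ be the uniform type-I triangulation of $\mathbb{R}^2$, obtained from the integer grid by drawing the north-east diagonal of every unit square, let $T$ be its set of triangles, and put $e_1=(1,0)$, $e_2=(0,1)$, $e_3=(1,1)$. Let $\mathcal{B}_{(1,1,1)}$ be the Courant hat function of the vertex $(1,1)$, i.e. the continuous function that is affine on every triangle of $G$, equals $1$ at $(1,1)$ and vanishes at every other point of $\mathbb{Z}^2$. For $\boldsymbol n=(n_1,n_2,n_3)\in\mathbb{Z}^3_{\ge 1}$ let $\mathcal{B}_{\boldsymbol n}$ be the type-I box spline, obtained from $\mathcal{B}_{(1,1,1)}$ by applying, for each $i\in\{1,2,3\}$, the operation $f\mapsto\int_0^1 f(\,\cdot-te_i)\,dt$ exactly $n_i-1$ times (the order does not matter). A translate $\mathcal{B}_{\boldsymbol n}(\cdot-v)$, $v\in\mathbb{Z}^2$, is called active on a triangle $\triangle\in T$ if it does not vanish identically on the closed triangle $\overline\triangle$. Let $\mathcal{S}_{\boldsymbol n}(\triangle)$ be the real linear span of the restrictions to $\overline\triangle$ of the active translates, and let $\mathcal{V}_{\boldsymbol n}|_\triangle\subseteq\mathbb{R}[x,y]$ be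 the space of polynomials whose restriction to $\overline\triangle$ lies in $\mathcal{S}_{\boldsymbol n}(\triangle)$. Then for every $\boldsymbol n\in\mathbb{Z}^3_{\ge1}$: (i) for every $\triangle\in T$, every element of $\mathcal{S}_{\boldsymbol n}(\triangle)$ is the restriction of a polynomial in $\mathcal{V}_{\boldsymbol n}|_\triangle$, and all polynomials in $\mathcal{V}_{\boldsymbol n}|_\triangle$ have total degree at most $n_1+n_2+n_3-2$; (ii) $\mathcal{V}_{\boldsymbol n}|_\triangle=\mathcal{V}_{\boldsymbol n}|_{\triangle'}$ for all $\triangle,\triangle'\in T$; (iii) this common space $\mathcal{V}_{\boldsymbol n}$ has dimension $n_1n_2+n_1n_3+n_2n_3$. -/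

import Mathlib

noncomputable section

namespace TypeIBoxSpline

/-- The plane `ℝ²`. -/
abbrev Plane : Type := Fin 2 → ℝ

/-- The three grid directions `e₁ = (1,0)`, `e₂ = (0,1)`, `e₃ = (1,1)`. -/
def dir : Fin 3 → Plane := ![![1, 0], ![0, 1], ![1, 1]]

/-- The lattice point `v ∈ ℤ²`, as a point of the plane. -/
def latticePoint (v : Fin 2 → ℤ) : Plane := fun k => (v k : ℝ)

/-- A triangle of the uniform type-I triangulation. The unit square with lower left corner
`v ∈ ℤ²` is cut by its north-east diagonal into a lower triangle, with vertices
`v, v + e₁, v + e₃`, and an upper one, with vertices `v, v + e₂, v + e₃`. -/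
structure GridTriangle where
  /-- The lower left corner of the unit square that contains the triangle. -/
  corner : Fin 2 → ℤ
  /-- Whether the triangle lies above the diagonal of that square. -/
  upper : Bool

/-- The closed triangle, as a subset of the plane. -/
def GridTriangle.carrier (T : GridTriangle) : Set Plane :=
  convexHull ℝ {latticePoint T.corner,
    latticePoint T.corner + (if T.upper then dir 1 else dir 0),
    latticePoint T.corner + dir 2}

/-- The Courant hat function of the vertex `(1,1)`: the continuous function that is affine on every
triangle of the grid, has the value `1` at `(1,1)`, and vanishes at every other lattice point. -/
def courantHat (x : Plane) : ℝ :=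
  max 0 (1 - max (max |x 0 - 1| |x 1 - 1|) |x 0 - x 1|)

/-- The convolution step in the direction `e`: `x ↦ ∫₀¹ f (x - t e) dt`. -/
def average (e : Plane) (f : Plane → ℝ) : Plane → ℝ :=
  fun x => ∫ t in (0 : ℝ)..1, f (x - t • e)

/-- The type-I box spline `B_n`, for `n = (n₁, n₂, n₃)` with all `nᵢ ≥ 1`: the Courant hat function
after `nᵢ - 1` convolution steps in each direction `eᵢ`. The order of the steps is irrelevant;
see `boxSpline_add_single`. -/
def boxSpline (n : Fin 3 → ℕ) : Plane → ℝ :=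
  (average (dir 0))^[n 0 - 1] ((average (dir 1))^[n 1 - 1]
    ((average (dir 2))^[n 2 - 1] courantHat))

/-- The translate `B_n(· - v)`, `v ∈ ℤ²`. -/
def boxSplineTranslate (n : Fin 3 → ℕ) (v : Fin 2 → ℤ) : Plane → ℝ :=
  fun x => boxSpline n (x - latticePoint v)

/-- The `v ∈ ℤ²` whose translate `B_n(· - v)` is active on `T`: its support, that is the set of
points where it does not vanish, meets the closed triangle. -/
def activeShifts (n : Fin 3 → ℕ) (T : GridTriangle) : Set (Fin 2 → ℤ) :=
  {v | (Function.support (boxSplineTranslate n v) ∩ T.carrier).Nonempty}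

/-- The restrictions of the active translates of `B_n` to the triangle `T`. -/
def activeBoxSplines (n : Fin 3 → ℕ) (T : GridTriangle) : Set (T.carrier → ℝ) :=
  (fun v (x : T.carrier) => boxSplineTranslate n v x) '' activeShifts n T

/-- The space of functions on `T` spanned by the restrictions of the active translates. -/
def activeSpan (n : Fin 3 → ℕ) (T : GridTriangle) : Submodule ℝ (T.carrier → ℝ) :=
  Submodule.span ℝ (activeBoxSplines n T)

/-- Restriction to `T` of the function that a bivariate polynomial defines on the plane. -/
def polyRestrict (T : GridTriangle) : MvPolynomial (Fin 2) ℝ →ₗ[ℝ] (T.carrier → ℝ) where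
  toFun p := fun x => MvPolynomial.eval (x : Plane) p
  map_add' p q := by ext x; simp
  map_smul' c p := by ext x; simp

/-- The polynomial space of `B_n` on the triangle `T`: all bivariate polynomials whose restriction
to `T` belongs to the span of the restrictions of the active translates. -/
def polySpace (n : Fin 3 → ℕ) (T : GridTriangle) : Submodule ℝ (MvPolynomial (Fin 2) ℝ) :=
  (activeSpan n T).comap (polyRestrict T)

/-! The recursion that characterizes the box splines holds in every direction. -/

theorem continuous_courantHat : Continuous courantHat := by
  unfold courantHat; fun_prop

theorem courantHat_one_one : courantHat ![1, 1] = 1 := by simp [courantHat]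

theorem courantHat_latticePoint (v : Fin 2 → ℤ) (hv : v ≠ ![1, 1]) :
    courantHat (latticePoint v) = 0 := by
  have h : v 0 ≠ 1 ∨ v 1 ≠ 1 := by
    by_contra! h
    exact hv (by ext i; fin_cases i <;> simp [h])
  have key : ∀ z : ℤ, z ≠ 1 → (1 : ℝ) ≤ |(z : ℝ) - 1| := fun z hz => by
    exact_mod_cast Int.one_le_abs (sub_ne_zero.2 hz)
  refine max_eq_left (sub_nonpos.2 (le_trans ?_ (le_max_left _ _)))
  rcases h with h | h
  · exact (key _ h).trans (le_max_left _ _)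
  · exact (key _ h).trans (le_max_right _ _)

theorem continuous_average (e : Plane) {f : Plane → ℝ} (hf : Continuous f) :
    Continuous (average e f) := by
  unfold average
  apply intervalIntegral.continuous_parametric_intervalIntegral_of_continuous'
  fun_prop

theorem continuous_iterate_average (e : Plane) {f : Plane → ℝ} (hf : Continuous f) (k : ℕ) :
    Continuous ((average e)^[k] f) := by
  induction k with
  | zero => exact hf
  | succ k ih => rw [Function.iterate_succ_apply']; exact continuous_average e ih

theorem average_comm (a b : Plane) {f : Plane → ℝ} (hf : Continuous f) :
    average a (average b f) = average b (average a f) := by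
  funext x
  unfold average
  rw [MeasureTheory.intervalIntegral_intervalIntegral_swap]
  · simp only [sub_right_comm]
  · have hc : Continuous (Function.uncurry fun t s : ℝ => f (x - t • a - s • b)) := by
      unfold Function.uncurry; fun_prop
    exact (hc.continuousOn.integrableOn_compact (isCompact_uIcc.prod isCompact_uIcc)).mono_set
      (Set.prod_mono Set.uIoc_subset_uIcc Set.uIoc_subset_uIcc)

theorem average_iterate_comm (a b : Plane) {f : Plane → ℝ} (hf : Continuous f) (k : ℕ) :
    average a ((average b)^[k] f) = (average b)^[k] (average a f) := by
  induction k with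
  | zero => rfl
  | succ k ih =>
    rw [Function.iterate_succ_apply', Function.iterate_succ_apply', ← ih,
      average_comm a b (continuous_iterate_average b hf k)]

theorem continuous_boxSpline (n : Fin 3 → ℕ) : Continuous (boxSpline n) :=
  continuous_iterate_average _ (continuous_iterate_average _
    (continuous_iterate_average _ continuous_courantHat _) _) _

theorem boxSpline_one : boxSpline 1 = courantHat := rfl

theorem boxSpline_add_single (n : Fin 3 → ℕ) (hn : ∀ i, 1 ≤ n i) (i : Fin 3) (x : Plane) :
    boxSpline (n + Pi.single i 1) x = ∫ t in (0 : ℝ)..1, boxSpline n (x - t • dir i) := by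
  have h : ∀ j, n j + 1 - 1 = (n j - 1) + 1 := fun j => by have := hn j; omega
  have c2 := continuous_iterate_average (dir 2) continuous_courantHat (n 2 - 1)
  have c1 := continuous_iterate_average (dir 1) c2 (n 1 - 1)
  suffices H : boxSpline (n + Pi.single i 1) = average (dir i) (boxSpline n) from congrFun H x
  fin_cases i
  · simp [boxSpline, -Function.iterate_succ, h, Function.iterate_succ_apply', -add_tsub_cancel_right]
  · simp [boxSpline, -Function.iterate_succ, h, Function.iterate_succ_apply', -add_tsub_cancel_right, average_iterate_comm (dir 1) (dir 0) c1]
  · simp [boxSpline, -Function.iterate_succ, h, Function.iterate_succ_apply', -add_tsub_cancel_right, average_iterate_comm (dir 2) (dir 0) c1, average_iterate_comm (dir 2) (dir 1) c2]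

end TypeIBoxSpline

end

/-!
The space `polySpace n T` is the same for all triangles because it is the space `derivKernel n` of
all polynomials `p` with `D_j ^ n_j D_k ^ n_k p = 0` for any two different indices `j`, `k`, where
`D_i` is the derivative along `dir i` (`polySpace_eq_derivKernel`).

Since translates that are not active vanish on `T`, the span of the active ones consists of the
restrictions of all splines `∑ c_v B_n(· - v)` with arbitrary coefficients `c` (`mem_activeSpan`).
A convolution step turns piecewise polynomials of degree `d` into piecewise polynomials of degree
`d + 1`, because the segment from `x` to `x - dir i` meets three triangles and the break points
depend affinely on `x` (`isPiecewisePolynomial_average`). This gives the polynomial pieces and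
their degree.

The main tool is the formula `D_i (∑ c_v B_{n + e_i}(· - v)) = ∑ (∇_i c)_v B_n(· - v)`, in which
`n + e_i` is `n` with `n_i` raised by one and `∇_i` is the backward difference
(`dirDeriv_eq_of_spline`). As `∇_i` is surjective, `D_i` maps
`polySpace (n + e_i) T` onto `polySpace n T`.

* `polySpace n T ≤ derivKernel n`: the formula reduces the equation `D_j ^ n_j D_k ^ n_k p = 0` to
  the case `n_j = n_k = 1`. In that case the box spline is, on each strip between consecutive grid
  lines of the third direction, a sum of a function that is constant along `dir j` and one that is
  constant along `dir k`. This is checked for the hat function and is preserved by convolution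
  along the third direction (`isStripSum_boxSpline`).
* `derivKernel n ≤ polySpace n T`, by induction on `n`: given `p` in `derivKernel (n + e_i)`,
  surjectivity of `D_i` provides a spline piece with the same derivative, so that `p` may be
  assumed to be constant along `dir i`. Such a `p` is a piece of a spline whose coefficients are
  constant along `dir i`; this is a second induction, which starts from the reproduction of linear
  polynomials (`exists_comp_transverse_of_dirDeriv_eq_zero`).
* The dimension: `D_i` maps `derivKernel (n + e_i)` onto `derivKernel n`, and its kernel there
  consists of the polynomials of degree less than `n_j + n_k` in the linear form that vanishes on
  `dir i` (`finrank_derivKernel`).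
-/

noncomputable section

namespace TypeIBoxSpline

open MvPolynomial

/-! ### Directional derivatives of bivariate polynomials -/

/-- The linear form that vanishes on `dir i`, over any ring of coordinates; its level lines are
the lines parallel to that direction. -/
def transverse {R : Type*} [Sub R] (i : Fin 3) (x : Fin 2 → R) : R := ![x 1, x 0, x 0 - x 1] i

/-- The directional derivative of a bivariate polynomial along `dir i`. -/
def dirDeriv (i : Fin 3) : Module.End ℝ (MvPolynomial (Fin 2) ℝ) :=
  (dir i 0 • pderiv 0 + dir i 1 • pderiv 1 :
    Derivation ℝ (MvPolynomial (Fin 2) ℝ) (MvPolynomial (Fin 2) ℝ)).toLinearMap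

theorem dirDeriv_mul_X (i : Fin 3) (p : MvPolynomial (Fin 2) ℝ) (k : Fin 2) :
    dirDeriv i (p * X k) = dirDeriv i p * X k + C (dir i k) * p := by
  fin_cases k <;> simp [dirDeriv, smul_eq_C_mul] <;> ring

theorem dirDeriv_C (i : Fin 3) (a : ℝ) : dirDeriv i (C a) = 0 := by
  simp [dirDeriv]

theorem commute_pderiv (k l : Fin 2) (p : MvPolynomial (Fin 2) ℝ) :
    pderiv k (pderiv l p) = pderiv l (pderiv k p) := by
  ext m
  rcases eq_or_ne k l with rfl | h
  · rfl
  · simp only [coeff_pderiv, Finsupp.add_apply, Finsupp.single_apply, h, h.symm, if_false]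
    rw [add_right_comm]; push_cast; ring

theorem dirDeriv_comm (i j : Fin 3) (p : MvPolynomial (Fin 2) ℝ) :
    dirDeriv i (dirDeriv j p) = dirDeriv j (dirDeriv i p) := by
  simp only [dirDeriv, Derivation.coeFn_coe, Derivation.add_apply, Derivation.smul_apply, map_add,
    map_smul, commute_pderiv 1 0 p]
  module

theorem commute_dirDeriv (i j : Fin 3) : Commute (dirDeriv i) (dirDeriv j) :=
  LinearMap.ext fun p => dirDeriv_comm i j p

theorem hasDerivAt_eval (i : Fin 3) (p : MvPolynomial (Fin 2) ℝ) (x : Plane) (s : ℝ) :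
    HasDerivAt (fun s : ℝ => eval (x + s • dir i) p) (eval (x + s • dir i) (dirDeriv i p)) s := by
  induction p using MvPolynomial.induction_on with
  | C a => simpa [dirDeriv_C] using hasDerivAt_const s a
  | add p q hp hq => simp only [map_add]; exact hp.add hq
  | mul_X p k hp =>
    have h1 : HasDerivAt (fun s : ℝ => x k + s * dir i k) (dir i k) s := by
      simpa using ((hasDerivAt_id s).mul_const (dir i k)).const_add (x k)
    rw [dirDeriv_mul_X]
    refine (hp.mul h1).congr_deriv ?_ |>.congr_of_eventuallyEq (.of_forall fun s => ?_)
    · simp [mul_comm]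
    · simp

theorem transverse_dir_self (i : Fin 3) : transverse i (dir i) = 0 := by
  fin_cases i <;> simp [transverse, dir]

theorem transverse_dir_succ (i : Fin 3) : transverse i (dir (i + 1)) = 1 := by
  fin_cases i <;> simp [transverse, dir]

theorem transverse_add_smul (i : Fin 3) (x y : Plane) (t : ℝ) :
    transverse i (x + t • y) = transverse i x + t * transverse i y := by
  fin_cases i <;> simp [transverse]; ring

theorem transverse_sub_smul (i : Fin 3) (x y : Plane) (t : ℝ) :
    transverse i (x - t • y) = transverse i x - t * transverse i y := by
  fin_cases i <;> simp [transverse]; ring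

theorem transverse_sub {R : Type*} [AddCommGroup R] (i : Fin 3) (x y : Fin 2 → R) :
    transverse i (x - y) = transverse i x - transverse i y := by
  fin_cases i <;> simp [transverse]; abel

theorem transverse_latticePoint (i : Fin 3) (v : Fin 2 → ℤ) :
    transverse i (latticePoint v) = (transverse i v : ℤ) := by
  fin_cases i <;> simp [transverse, latticePoint]

/-- Every point is reached from the line spanned by `dir (i + 1)` along `dir i`. -/
theorem exists_eq_transverse_smul_add (i : Fin 3) (x : Plane) :
    ∃ s : ℝ, x = transverse i x • dir (i + 1) + s • dir i := by
  refine ⟨![x 0, x 1 - x 0, x 1] i, ?_⟩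
  ext k
  fin_cases i <;> fin_cases k <;> simp [transverse, dir]

/-- The bivariate polynomial `r (ℓ_i (x, y))`, for the transverse form `ℓ_i`. -/
def ridge (i : Fin 3) : Polynomial ℝ →ₐ[ℝ] MvPolynomial (Fin 2) ℝ :=
  Polynomial.aeval (transverse i X)

theorem eval_ridge (i : Fin 3) (r : Polynomial ℝ) (x : Plane) :
    eval x (ridge i r) = r.eval (transverse i x) := by
  have h : eval x (transverse i X) = transverse i x := by fin_cases i <;> simp [transverse]
  rw [ridge, Polynomial.aeval_def, Polynomial.hom_eval₂, h, Polynomial.eval₂_eq_eval_map,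
    show (eval x).comp (algebraMap ℝ (MvPolynomial (Fin 2) ℝ)) = RingHom.id ℝ by ext; simp,
    Polynomial.map_id]

theorem ridge_injective (i : Fin 3) : Function.Injective (ridge i) := by
  intro p q h
  refine Polynomial.funext fun u => ?_
  have := congrArg (eval (0 + u • dir (i + 1))) h
  have h0 : transverse i (0 : Plane) = 0 := by fin_cases i <;> simp [transverse]
  rwa [eval_ridge, eval_ridge, transverse_add_smul, transverse_dir_succ, h0, zero_add, mul_one]
    at this

theorem dirDeriv_ridge (l i : Fin 3) (r : Polynomial ℝ) :
    dirDeriv l (ridge i r) = transverse i (dir l) • ridge i r.derivative := by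
  have h : dirDeriv l (transverse i X) = C (transverse i (dir l)) := by
    fin_cases i <;> simp [transverse, dirDeriv, smul_eq_C_mul, sub_eq_add_neg]
  have := Derivation.map_aeval (dir l 0 • pderiv 0 + dir l 1 • pderiv 1 :
    Derivation ℝ (MvPolynomial (Fin 2) ℝ) (MvPolynomial (Fin 2) ℝ)) r (transverse i X)
  rw [ridge, smul_eq_C_mul, ← h, mul_comm]
  exact this

theorem eval_aeval_C_mul_X (f : Fin 2 → ℝ) (p : MvPolynomial (Fin 2) ℝ) (u : ℝ) :
    (MvPolynomial.aeval (fun k => Polynomial.C (f k) * Polynomial.X) p).eval u =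
      eval (u • f) p := by
  induction p using MvPolynomial.induction_on with
  | C a => simp only [algHom_C, Polynomial.algebraMap_eq, Polynomial.eval_C, eval_C]
  | add p q hp hq => simp [hp, hq]
  | mul_X p k hp =>
    simp only [map_mul, aeval_X, Polynomial.eval_mul, hp, Polynomial.eval_C, Polynomial.eval_X,
      eval_X, Pi.smul_apply, smul_eq_mul, mul_comm u]

/-- A polynomial without derivative along `dir i` is constant on the lines parallel to it. -/
theorem exists_ridge_of_dirDeriv_eq_zero {i : Fin 3} {p : MvPolynomial (Fin 2) ℝ}
    (hp : dirDeriv i p = 0) : ∃ r, ridge i r = p := by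
  refine ⟨MvPolynomial.aeval (fun k => Polynomial.C (dir (i + 1) k) * Polynomial.X) p,
    MvPolynomial.funext fun x => ?_⟩
  obtain ⟨s, hs⟩ := exists_eq_transverse_smul_add i x
  have hc := is_const_of_deriv_eq_zero (f := fun s : ℝ => eval (transverse i x • dir (i + 1) +
      s • dir i) p) (fun s => (hasDerivAt_eval i p _ s).differentiableAt)
    (fun s => by rw [(hasDerivAt_eval i p _ s).deriv, hp, map_zero]) 0 s
  simp only [zero_smul, add_zero, ← hs] at hc
  rw [eval_ridge, ← hc, eval_aeval_C_mul_X]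

theorem eq_C_of_dirDeriv_eq_zero {i j : Fin 3} (hij : i ≠ j) {p : MvPolynomial (Fin 2) ℝ}
    (hi : dirDeriv i p = 0) (hj : dirDeriv j p = 0) : ∃ a, p = C a := by
  obtain ⟨r, rfl⟩ := exists_ridge_of_dirDeriv_eq_zero hi
  rw [dirDeriv_ridge] at hj
  have hne : transverse i (dir j) ≠ 0 := by
    fin_cases i <;> fin_cases j <;> simp [transverse, dir] at hij ⊢
  have h0 : r.derivative = 0 :=
    ridge_injective i (by rw [(smul_eq_zero.1 hj).resolve_left hne, map_zero])
  refine ⟨r.coeff 0, ?_⟩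
  conv_lhs => rw [Polynomial.eq_C_of_derivative_eq_zero h0]
  simp [ridge, MvPolynomial.algebraMap_eq]

/-! ### The common kernel of the mixed derivatives -/

/-- The polynomials that are annihilated by `D_j ^ n_j D_k ^ n_k` for any two of the three
directional derivatives. -/
def derivKernel (n : Fin 3 → ℕ) : Submodule ℝ (MvPolynomial (Fin 2) ℝ) :=
  ⨅ i : Fin 3, LinearMap.ker (dirDeriv (i + 1) ^ n (i + 1) * dirDeriv (i + 2) ^ n (i + 2))

theorem mem_derivKernel {n : Fin 3 → ℕ} {p : MvPolynomial (Fin 2) ℝ} : p ∈ derivKernel n ↔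
    ∀ i : Fin 3, (dirDeriv (i + 1) ^ n (i + 1)) ((dirDeriv (i + 2) ^ n (i + 2)) p) = 0 := by
  simp [derivKernel, Submodule.mem_iInf]

theorem eq_or_eq_add (i j : Fin 3) : j = i ∨ j = i + 1 ∨ j = i + 2 := by
  decide +revert

theorem add_ne_self (i : Fin 3) : i + 1 ≠ i ∧ i + 2 ≠ i ∧ i + 1 ≠ i + 2 := by
  decide +revert

theorem add_add_eq (i : Fin 3) :
    i + 1 + 1 = i + 2 ∧ i + 1 + 2 = i ∧ i + 2 + 1 = i ∧ i + 2 + 2 = i + 1 := by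
  decide +revert

/-- Membership in `derivKernel` does not depend on the order of the two derivatives. -/
theorem pow_dirDeriv_eq_zero_of_mem {n : Fin 3 → ℕ} {p : MvPolynomial (Fin 2) ℝ}
    (hp : p ∈ derivKernel n) {j k : Fin 3} (hjk : j ≠ k) :
    (dirDeriv j ^ n j) ((dirDeriv k ^ n k) p) = 0 := by
  have h := mem_derivKernel.1 hp
  rcases eq_or_eq_add j k with rfl | rfl | rfl
  · exact absurd rfl hjk
  · have h' := h (j + 2)
    rw [(add_add_eq j).2.2.1, (add_add_eq j).2.2.2] at h'
    exact h'
  · have h' := h (j + 1)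
    rw [(add_add_eq j).1, (add_add_eq j).2.1] at h'
    rw [← h']
    exact LinearMap.congr_fun ((commute_dirDeriv j (j + 2)).pow_pow _ _) p

theorem dirDeriv_mem_derivKernel {n : Fin 3 → ℕ} {l : Fin 3} {p : MvPolynomial (Fin 2) ℝ}
    (hp : p ∈ derivKernel (n + Pi.single l 1)) : dirDeriv l p ∈ derivKernel n := by
  have hc : ∀ (j : Fin 3) (m : ℕ) (q : MvPolynomial (Fin 2) ℝ),
      (dirDeriv j ^ m) (dirDeriv l q) = dirDeriv l ((dirDeriv j ^ m) q) := fun j m q =>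
    LinearMap.congr_fun ((commute_dirDeriv j l).pow_left m) q
  refine mem_derivKernel.2 fun i => ?_
  have h := mem_derivKernel.1 hp i
  obtain ⟨h1, h2, h3⟩ := add_ne_self i
  rcases eq_or_eq_add i l with rfl | rfl | rfl
  · rw [hc, hc]
    simpa [h1, h2] using congrArg (dirDeriv l) h
  · rw [hc]
    simpa [h1, h2, h3.symm, pow_succ] using h
  · simpa [h1, h2, h3, pow_succ] using h

theorem pow_dirDeriv_ridge (l i : Fin 3) (r : Polynomial ℝ) (k : ℕ) :
    (dirDeriv l ^ k) (ridge i r) =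
      transverse i (dir l) ^ k • ridge i (Polynomial.derivative^[k] r) := by
  induction k with
  | zero => simp
  | succ k ih =>
    rw [pow_succ', Module.End.mul_apply, ih, map_smul, dirDeriv_ridge, smul_smul, pow_succ,
      Function.iterate_succ_apply']

theorem iterate_derivative_eq_zero_iff (r : Polynomial ℝ) (k : ℕ) :
    Polynomial.derivative^[k] r = 0 ↔ r ∈ Polynomial.degreeLT ℝ k := by
  refine ⟨fun h => ?_, fun h => Polynomial.iterate_derivative_eq_zero_of_degree_lt
    (Polynomial.mem_degreeLT.1 h)⟩
  rw [Polynomial.mem_degreeLT, Polynomial.degree_lt_iff_coeff_zero]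
  intro m hm
  have := congrArg (fun q => Polynomial.coeff q (m - k)) h
  simp only [Polynomial.coeff_iterate_derivative, Nat.sub_add_cancel hm, Polynomial.coeff_zero,
    nsmul_eq_mul, mul_eq_zero, Nat.cast_eq_zero, Nat.descFactorial_eq_zero_iff_lt] at this
  exact this.resolve_left (by omega)

theorem transverse_dir_ne_zero {i j : Fin 3} (h : j ≠ i) : transverse i (dir j) ≠ 0 := by
  fin_cases i <;> fin_cases j <;> simp [transverse, dir] at h ⊢

/-- The polynomials of `derivKernel n` that are constant along `dir i` are the polynomials of degree
less than `n_j + n_k` in the transverse form, where `j` and `k` are the other two indices. -/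
theorem derivKernel_inf_ker {n : Fin 3 → ℕ} {i : Fin 3} (hi : 1 ≤ n i) :
    derivKernel n ⊓ LinearMap.ker (dirDeriv i) =
      (Polynomial.degreeLT ℝ (n (i + 1) + n (i + 2))).map (ridge i).toLinearMap := by
  obtain ⟨h1, h2, h3⟩ := add_ne_self i
  have key : ∀ r : Polynomial ℝ, (dirDeriv (i + 1) ^ n (i + 1))
      ((dirDeriv (i + 2) ^ n (i + 2)) (ridge i r)) = 0 ↔
      r ∈ Polynomial.degreeLT ℝ (n (i + 1) + n (i + 2)) := fun r => by
    rw [pow_dirDeriv_ridge, map_smul, pow_dirDeriv_ridge, smul_smul,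
      ← Function.iterate_add_apply, smul_eq_zero, or_iff_right, ← iterate_derivative_eq_zero_iff]
    · exact map_eq_zero_iff _ (ridge_injective i)
    · exact mul_ne_zero (pow_ne_zero _ (transverse_dir_ne_zero h2))
        (pow_ne_zero _ (transverse_dir_ne_zero h1))
  ext p
  constructor
  · rintro ⟨hp, hpi⟩
    obtain ⟨r, rfl⟩ := exists_ridge_of_dirDeriv_eq_zero hpi
    exact ⟨r, (key r).1 (mem_derivKernel.1 hp i), rfl⟩
  · rintro ⟨r, hr, rfl⟩
    have hker : ∀ m, 1 ≤ m → (dirDeriv i ^ m) (ridge i r) = 0 := fun m hm => by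
      rw [pow_dirDeriv_ridge, transverse_dir_self, zero_pow (by omega), zero_smul]
    refine ⟨mem_derivKernel.2 fun l => ?_, by simpa using hker 1 le_rfl⟩
    rcases eq_or_eq_add i l with rfl | rfl | rfl
    · exact (key r).2 hr
    · rw [(add_add_eq i).2.1]
      simp [hker _ hi]
    · rw [(add_add_eq i).2.2.1]
      have := LinearMap.congr_fun ((commute_dirDeriv i (i + 2 + 2)).pow_pow (n i) (n (i + 2 + 2)))
        (ridge i r)
      simpa [hker _ hi] using this

theorem finrank_derivKernel_inf_ker {n : Fin 3 → ℕ} {i : Fin 3} (hi : 1 ≤ n i) :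
    Module.finrank ℝ ↥(derivKernel n ⊓ LinearMap.ker (dirDeriv i)) = n (i + 1) + n (i + 2) := by
  rw [derivKernel_inf_ker hi,
    ← (Submodule.equivMapOfInjective _ (ridge_injective i) _).finrank_eq,
    (Polynomial.degreeLTEquiv ℝ _).finrank_eq, Module.finrank_fin_fun]

/-! ### Triangles and piecewise polynomials -/

theorem totalDegree_bind₁_le {σ τ : Type*} (f : σ → MvPolynomial τ ℝ)
    (hf : ∀ k, (f k).totalDegree ≤ 1) (p : MvPolynomial σ ℝ) :
    (bind₁ f p).totalDegree ≤ p.totalDegree := by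
  rw [bind₁, aeval_def, eval₂_eq]
  refine totalDegree_finsetSum_le fun m hm => ?_
  refine (totalDegree_mul _ _).trans ?_
  rw [algebraMap_eq, totalDegree_C, zero_add]
  refine ((totalDegree_finsetProd _ _).trans (Finset.sum_le_sum fun k _ => ?_)).trans
    (le_totalDegree hm)
  exact (totalDegree_pow _ _).trans (by simpa using Nat.mul_le_mul_left (m k) (hf k))

/-- Integration of a polynomial along a segment whose end points depend affinely on the point
raises the total degree by at most one. -/
theorem exists_eval_eq_integral (p : MvPolynomial (Fin 2) ℝ) {d : ℕ} (hp : p.totalDegree ≤ d)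
    (e : Plane) {a b : MvPolynomial (Fin 2) ℝ} (ha : a.totalDegree ≤ 1) (hb : b.totalDegree ≤ 1) :
    ∃ q : MvPolynomial (Fin 2) ℝ, q.totalDegree ≤ d + 1 ∧
      ∀ x : Plane, eval x q = ∫ t in eval x a..eval x b, eval (x - t • e) p := by
  -- The integrand, as a polynomial in the point (variables `some k`) and in `t` (variable `none`).
  let f : Fin 2 → MvPolynomial (Option (Fin 2)) ℝ := fun k => X (some k) - C (e k) * X none
  have hf : ∀ k, (f k).totalDegree ≤ 1 := fun k => by
    refine (totalDegree_sub _ _).trans (max_le (totalDegree_X _).le ?_)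
    refine (totalDegree_mul _ _).trans ?_
    rw [totalDegree_C, totalDegree_X]
  set r := bind₁ f p with hr
  have hrd : r.totalDegree ≤ d := (totalDegree_bind₁_le f hf p).trans hp
  have hre : ∀ (x : Plane) (t : ℝ), eval (x - t • e) p =
      ∑ m ∈ r.support, coeff m r * (t ^ m none * ∏ k, x k ^ m (some k)) := fun x t => by
    have h1 : eval (fun o : Option (Fin 2) => o.elim t x) r = eval (x - t • e) p := by
      rw [hr, eval, eval₂Hom_bind₁]
      congr 2
      ext k
      simp [f, mul_comm]
    rw [← h1, eval_eq']
    simp [Fintype.prod_option]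
  refine ⟨∑ m ∈ r.support, C (coeff m r / (m none + 1)) *
    ((b ^ (m none + 1) - a ^ (m none + 1)) * ∏ k, X k ^ m (some k)), ?_, fun x => ?_⟩
  · refine totalDegree_finsetSum_le fun m hm => ?_
    have h1 : m none + ∑ k, m (some k) ≤ d := by
      refine le_trans (le_of_eq ?_) ((le_totalDegree hm).trans hrd)
      rw [Finsupp.sum_fintype _ _ (fun _ => rfl), Fintype.sum_option]
    have h2 : (∏ k, X k ^ m (some k) : MvPolynomial (Fin 2) ℝ).totalDegree ≤ ∑ k, m (some k) :=
      (totalDegree_finsetProd _ _).trans (Finset.sum_le_sum fun k _ => (totalDegree_X_pow _ _).le)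
    have h3 : ∀ {c : MvPolynomial (Fin 2) ℝ}, c.totalDegree ≤ 1 →
        (c ^ (m none + 1)).totalDegree ≤ m none + 1 := fun hc =>
      (totalDegree_pow _ _).trans (by simpa using Nat.mul_le_mul_left (m none + 1) hc)
    have h4 := (totalDegree_sub (b ^ (m none + 1)) (a ^ (m none + 1))).trans
      (max_le (h3 hb) (h3 ha))
    refine (totalDegree_mul _ _).trans ?_
    rw [totalDegree_C, zero_add]
    exact (totalDegree_mul _ _).trans (by omega)
  · simp_rw [hre]
    rw [intervalIntegral.integral_finsetSum
      (fun m _ => Continuous.intervalIntegrable (by fun_prop) _ _)]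
    simp only [intervalIntegral.integral_const_mul, intervalIntegral.integral_mul_const,
      integral_pow, map_sum, map_mul, map_sub, map_pow, map_prod, eval_C, eval_X]
    refine Finset.sum_congr rfl fun m _ => ?_
    ring

@[simp] theorem dir_apply : dir 0 0 = 1 ∧ dir 0 1 = 0 ∧ dir 1 0 = 0 ∧ dir 1 1 = 1 ∧
    dir 2 0 = 1 ∧ dir 2 1 = 1 := by
  simp [dir]

@[simp] theorem latticePoint_apply (v : Fin 2 → ℤ) (k : Fin 2) : latticePoint v k = v k := rfl

/-- A closed triangle, described by the coordinates relative to its corner. -/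
theorem mem_carrier (v : Fin 2 → ℤ) (u : Bool) (x : Plane) :
    x ∈ (GridTriangle.mk v u).carrier ↔
      if u then 0 ≤ x 0 - v 0 ∧ x 0 - v 0 ≤ x 1 - v 1 ∧ x 1 - v 1 ≤ 1
      else 0 ≤ x 1 - v 1 ∧ x 1 - v 1 ≤ x 0 - v 0 ∧ x 0 - v 0 ≤ 1 := by
  constructor
  · intro hx
    refine convexHull_min (t := {x : Plane | if u then 0 ≤ x 0 - v 0 ∧ x 0 - v 0 ≤ x 1 - v 1 ∧
      x 1 - v 1 ≤ 1 else 0 ≤ x 1 - v 1 ∧ x 1 - v 1 ≤ x 0 - v 0 ∧ x 0 - v 0 ≤ 1}) ?_ ?_ hx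
    · rintro y (rfl | rfl | rfl) <;> cases u <;> simp [add_comm]
    · intro y hy z hz a b ha hb hab
      obtain rfl : b = 1 - a := by linarith
      cases u <;> simp at hy hz ⊢ <;> refine ⟨?_, ?_, ?_⟩ <;> nlinarith
  · intro hx
    have hc := (convex_convexHull ℝ {latticePoint v,
      latticePoint v + (if u then dir 1 else dir 0), latticePoint v + dir 2}).sum_mem
      (t := Finset.univ) (w := if u then ![1 - (x 1 - v 1), (x 1 - v 1) - (x 0 - v 0), x 0 - v 0]
        else ![1 - (x 0 - v 0), (x 0 - v 0) - (x 1 - v 1), x 1 - v 1])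
      (z := ![latticePoint v, latticePoint v + (if u then dir 1 else dir 0),
        latticePoint v + dir 2])
      (fun i _ => by cases u <;> fin_cases i <;> simp at hx ⊢ <;> linarith)
      (by cases u <;> simp [Fin.sum_univ_three])
      (fun i _ => subset_convexHull ℝ _ (by fin_cases i <;> simp))
    refine Set.mem_of_eq_of_mem (funext fun k => ?_) hc
    cases u <;> fin_cases k <;> simp [Fin.sum_univ_three] <;> ring

/-- The sides of an open square inside the triangle, at the corner with the right angle. -/
def GridTriangle.box (T : GridTriangle) (k : Fin 2) : Set ℝ :=
  if T.upper = (k = 0 : Bool) then Set.Ioo (T.corner k : ℝ) (T.corner k + 1 / 2)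
  else Set.Ioo (T.corner k + 1 / 2 : ℝ) (T.corner k + 1)

theorem pi_box_subset (T : GridTriangle) : Set.pi Set.univ T.box ⊆ T.carrier := by
  obtain ⟨v, u⟩ := T
  intro x hx
  have h0 := hx 0 trivial
  have h1 := hx 1 trivial
  rw [mem_carrier]
  cases u <;> simp [GridTriangle.box] at h0 h1 ⊢ <;> refine ⟨?_, ?_, ?_⟩ <;> linarith

theorem isOpen_pi_box (T : GridTriangle) : IsOpen (Set.pi Set.univ T.box) :=
  isOpen_set_pi Set.finite_univ fun k _ => by
    unfold GridTriangle.box; split_ifs <;> exact isOpen_Ioo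

theorem eq_of_eval_eq_on_box {T : GridTriangle} {p q : MvPolynomial (Fin 2) ℝ}
    (h : ∀ x ∈ Set.pi Set.univ T.box, eval x p = eval x q) : p = q :=
  funext_set T.box (fun k => by
    unfold GridTriangle.box; split_ifs <;> exact Set.Ioo_infinite (by linarith)) h

/-- A function that coincides on every triangle with a polynomial of total degree at most `d`. -/
def IsPiecewisePolynomial (d : ℕ) (f : Plane → ℝ) : Prop :=
  ∀ T : GridTriangle, ∃ p : MvPolynomial (Fin 2) ℝ, p.totalDegree ≤ d ∧
    ∀ x ∈ T.carrier, eval x p = f x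

/-- The linear polynomial `α + β x + γ y`. -/
def affinePoly (α β γ : ℝ) : MvPolynomial (Fin 2) ℝ := C α + C β * X 0 + C γ * X 1

theorem eval_affinePoly (α β γ : ℝ) (x : Plane) :
    eval x (affinePoly α β γ) = α + β * x 0 + γ * x 1 := by
  simp [affinePoly]

theorem totalDegree_affinePoly (α β γ : ℝ) : (affinePoly α β γ).totalDegree ≤ 1 := by
  have h : ∀ (c : ℝ) (k : Fin 2), (C c * X k : MvPolynomial (Fin 2) ℝ).totalDegree ≤ 1 :=
    fun c k => (totalDegree_mul _ _).trans (by rw [totalDegree_C, totalDegree_X])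
  refine (totalDegree_add _ _).trans (max_le ((totalDegree_add _ _).trans (max_le ?_ (h _ _)))
    (h _ _))
  rw [totalDegree_C]; exact Nat.zero_le _

/-- The segment from `x ∈ T` to `x - e` runs through three triangles, with break points that depend
affinely on `x`. -/
theorem exists_eval_eq_average {d : ℕ} {f : Plane → ℝ} (hc : Continuous f)
    (hf : IsPiecewisePolynomial d f) (e : Plane) {T T₁ T₂ : GridTriangle} (α β γ α' β' γ' : ℝ)
    (h0 : ∀ x ∈ T.carrier, 0 ≤ α + β * x 0 + γ * x 1)
    (h1 : ∀ x ∈ T.carrier, α + β * x 0 + γ * x 1 ≤ α' + β' * x 0 + γ' * x 1)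
    (h2 : ∀ x ∈ T.carrier, α' + β' * x 0 + γ' * x 1 ≤ 1)
    (hT : ∀ x ∈ T.carrier, ∀ t, 0 ≤ t → t ≤ α + β * x 0 + γ * x 1 → x - t • e ∈ T.carrier)
    (hT₁ : ∀ x ∈ T.carrier, ∀ t, α + β * x 0 + γ * x 1 ≤ t → t ≤ α' + β' * x 0 + γ' * x 1 →
      x - t • e ∈ T₁.carrier)
    (hT₂ : ∀ x ∈ T.carrier, ∀ t, α' + β' * x 0 + γ' * x 1 ≤ t → t ≤ 1 → x - t • e ∈ T₂.carrier) :
    ∃ p : MvPolynomial (Fin 2) ℝ, p.totalDegree ≤ d + 1 ∧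
      ∀ x ∈ T.carrier, eval x p = average e f x := by
  obtain ⟨p, hpd, hp⟩ := hf T
  obtain ⟨p₁, hpd₁, hp₁⟩ := hf T₁
  obtain ⟨p₂, hpd₂, hp₂⟩ := hf T₂
  have hA := totalDegree_affinePoly α β γ
  have hB := totalDegree_affinePoly α' β' γ'
  obtain ⟨q, hqd, hq⟩ := exists_eval_eq_integral p hpd e
    (totalDegree_affinePoly 0 0 0) hA
  obtain ⟨q₁, hqd₁, hq₁⟩ := exists_eval_eq_integral p₁ hpd₁ e hA hB
  obtain ⟨q₂, hqd₂, hq₂⟩ := exists_eval_eq_integral p₂ hpd₂ e hB (totalDegree_affinePoly 1 0 0)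
  refine ⟨q + q₁ + q₂, (totalDegree_add _ _).trans
    (max_le ((totalDegree_add _ _).trans (max_le hqd hqd₁)) hqd₂), fun x hx => ?_⟩
  have hi : ∀ a b : ℝ, IntervalIntegrable (fun t : ℝ => f (x - t • e)) MeasureTheory.volume a b :=
    fun a b => Continuous.intervalIntegrable (by fun_prop) a b
  rw [map_add, map_add, hq, hq₁, hq₂, average,
    ← intervalIntegral.integral_add_adjacent_intervals
      (hi 0 (eval x (affinePoly α' β' γ'))) (hi _ 1),
    ← intervalIntegral.integral_add_adjacent_intervals (hi 0 (eval x (affinePoly α β γ))) (hi _ _)]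
  simp only [eval_affinePoly, zero_mul, add_zero]
  congr 1
  · congr 1
    · refine intervalIntegral.integral_congr fun t ht => ?_
      rw [Set.uIcc_of_le (h0 x hx)] at ht
      exact hp _ (hT x hx t ht.1 ht.2)
    · refine intervalIntegral.integral_congr fun t ht => ?_
      rw [Set.uIcc_of_le (h1 x hx)] at ht
      exact hp₁ _ (hT₁ x hx t ht.1 ht.2)
  · refine intervalIntegral.integral_congr fun t ht => ?_
    rw [Set.uIcc_of_le (h2 x hx)] at ht
    exact hp₂ _ (hT₂ x hx t ht.1 ht.2)

/-- A convolution step along a grid direction keeps the grid and raises the degree by one. -/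
theorem isPiecewisePolynomial_average {d : ℕ} {f : Plane → ℝ} (hc : Continuous f)
    (hf : IsPiecewisePolynomial d f) (i : Fin 3) :
    IsPiecewisePolynomial (d + 1) (average (dir i) f) := by
  rintro ⟨v, u⟩
  -- The segment starts in the given triangle and passes `T₁` before it ends in `T₂`, the translate
  -- of the given triangle by `-dir i`.
  fin_cases i <;> cases u
  · refine exists_eval_eq_average hc hf (dir 0) (T₁ := ⟨v, true⟩) (T₂ := ⟨![v 0 - 1, v 1], false⟩)
      (v 1 - v 0) 1 (-1) (-v 0) 1 0 ?_ ?_ ?_ ?_ ?_ ?_ <;> intro x hx <;>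
      simp [mem_carrier] at hx ⊢ <;> grind
  · refine exists_eval_eq_average hc hf (dir 0) (T₁ := ⟨![v 0 - 1, v 1], false⟩)
      (T₂ := ⟨![v 0 - 1, v 1], true⟩)
      (-v 0) 1 0 (1 - v 0 + v 1) 1 (-1) ?_ ?_ ?_ ?_ ?_ ?_ <;> intro x hx <;>
      simp [mem_carrier] at hx ⊢ <;> grind
  · refine exists_eval_eq_average hc hf (dir 1) (T₁ := ⟨![v 0, v 1 - 1], true⟩)
      (T₂ := ⟨![v 0, v 1 - 1], false⟩)
      (-v 1) 0 1 (1 - v 1 + v 0) (-1) 1 ?_ ?_ ?_ ?_ ?_ ?_ <;> intro x hx <;>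
      simp [mem_carrier] at hx ⊢ <;> grind
  · refine exists_eval_eq_average hc hf (dir 1) (T₁ := ⟨v, false⟩) (T₂ := ⟨![v 0, v 1 - 1], true⟩)
      (v 0 - v 1) (-1) 1 (-v 1) 0 1 ?_ ?_ ?_ ?_ ?_ ?_ <;> intro x hx <;>
      simp [mem_carrier] at hx ⊢ <;> grind
  · refine exists_eval_eq_average hc hf (dir 2) (T₁ := ⟨![v 0, v 1 - 1], true⟩)
      (T₂ := ⟨![v 0 - 1, v 1 - 1], false⟩)
      (-v 1) 0 1 (-v 0) 1 0 ?_ ?_ ?_ ?_ ?_ ?_ <;> intro x hx <;>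
      simp [mem_carrier] at hx ⊢ <;> grind
  · refine exists_eval_eq_average hc hf (dir 2) (T₁ := ⟨![v 0 - 1, v 1], false⟩)
      (T₂ := ⟨![v 0 - 1, v 1 - 1], true⟩)
      (-v 0) 1 0 (-v 1) 0 1 ?_ ?_ ?_ ?_ ?_ ?_ <;> intro x hx <;>
      simp [mem_carrier] at hx ⊢ <;> grind

/-! ### The hat function on strips -/

/-- The function `u ↦ min (max u 0) 1`. -/
def ramp (u : ℝ) : ℝ := max 0 (min 1 u)

theorem continuous_ramp : Continuous ramp := by unfold ramp; fun_prop

theorem exists_ramp_eq_affine (m : ℤ) :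
    ∃ a b : ℝ, ∀ u : ℝ, m ≤ u → u ≤ m + 1 → ramp u = a + b * u := by
  rcases lt_trichotomy m 0 with h | rfl | h
  · refine ⟨0, 0, fun u h1 h2 => ?_⟩
    have : (m : ℝ) + 1 ≤ 0 := by exact_mod_cast h
    rw [ramp, min_eq_right (by linarith), max_eq_left (by linarith)]; ring
  · refine ⟨0, 1, fun u h1 h2 => ?_⟩
    norm_num at h1 h2
    rw [ramp, min_eq_right h2, max_eq_right h1]; ring
  · refine ⟨1, 0, fun u h1 h2 => ?_⟩
    have : (1 : ℝ) ≤ m := by exact_mod_cast h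
    rw [ramp, min_eq_left (by linarith), max_eq_right (by linarith)]; ring

theorem courantHat_eq_zero {x : Plane} (h : 1 ≤ |x 0 - 1| ∨ 1 ≤ |x 1 - 1| ∨ 1 ≤ |x 0 - x 1|) :
    courantHat x = 0 := by
  refine max_eq_left (sub_nonpos.2 ?_)
  rcases h with h | h | h
  · exact h.trans ((le_max_left _ _).trans (le_max_left _ _))
  · exact h.trans ((le_max_right _ _).trans (le_max_left _ _))
  · exact h.trans (le_max_right _ _)

theorem courantHat_of_snd_mem_zero_one {x : Plane} (h1 : 0 ≤ x 1) (h2 : x 1 ≤ 1) :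
    courantHat x = ramp (x 0) - ramp (x 0 - x 1) := by
  unfold courantHat ramp
  generalize x 0 = a at *
  generalize x 1 = b at *
  grind

theorem courantHat_of_snd_mem_one_two {x : Plane} (h1 : 1 ≤ x 1) (h2 : x 1 ≤ 2) :
    courantHat x = ramp (x 0 - x 1 + 1) - ramp (x 0 - 1) := by
  unfold courantHat ramp
  generalize x 0 = a at *
  generalize x 1 = b at *
  grind

theorem courantHat_of_fst_mem_zero_one {x : Plane} (h1 : 0 ≤ x 0) (h2 : x 0 ≤ 1) :
    courantHat x = ramp (x 0 - x 1 + 1) - 1 + ramp (x 1) := by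
  unfold courantHat ramp
  generalize x 0 = a at *
  generalize x 1 = b at *
  grind

theorem courantHat_of_fst_mem_one_two {x : Plane} (h1 : 1 ≤ x 0) (h2 : x 0 ≤ 2) :
    courantHat x = 1 - ramp (x 0 - x 1) - ramp (x 1 - 1) := by
  unfold courantHat ramp
  generalize x 0 = a at *
  generalize x 1 = b at *
  grind

theorem courantHat_of_sub_mem_zero_one {x : Plane} (h1 : 0 ≤ x 0 - x 1) (h2 : x 0 - x 1 ≤ 1) :
    courantHat x = ramp (x 1) - ramp (x 0 - 1) := by
  unfold courantHat ramp
  generalize x 0 = a at *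
  generalize x 1 = b at *
  grind

theorem courantHat_of_sub_mem_neg_one_zero {x : Plane} (h1 : -1 ≤ x 0 - x 1) (h2 : x 0 - x 1 ≤ 0) :
    courantHat x = ramp (x 0) - ramp (x 1 - 1) := by
  unfold courantHat ramp
  generalize x 0 = a at *
  generalize x 1 = b at *
  grind

/-- On a strip between consecutive grid lines of one direction, the hat function is the sum of two
functions, each of which is constant along one of the other two directions. -/
theorem courantHat_eq_on_strip (i : Fin 3) (m : ℤ) : ∃ (κ σ κ' σ' : ℝ) (a b : ℤ), ∀ x : Plane,
    m ≤ transverse i x → transverse i x ≤ m + 1 → courantHat x =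
      (κ + σ * ramp (transverse (i + 1) x + a)) + (κ' + σ' * ramp (transverse (i + 2) x + b)) := by
  have hzero : (∀ x : Plane, m ≤ transverse i x → transverse i x ≤ m + 1 → courantHat x = 0) →
      ∃ (κ σ κ' σ' : ℝ) (a b : ℤ), ∀ x : Plane,
        m ≤ transverse i x → transverse i x ≤ m + 1 → courantHat x =
        (κ + σ * ramp (transverse (i + 1) x + a)) + (κ' + σ' * ramp (transverse (i + 2) x + b)) :=
    fun h => ⟨0, 0, 0, 0, 0, 0, fun x h1 h2 => by rw [h x h1 h2]; ring⟩
  fin_cases i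
  · have hm : m = 0 ∨ m = 1 ∨ m + 1 ≤ 0 ∨ 2 ≤ m := by omega
    rcases hm with rfl | rfl | hm | hm
    · refine ⟨0, 1, 0, -1, 0, 0, fun x h1 h2 => ?_⟩
      simp [transverse] at h1 h2 ⊢
      rw [courantHat_of_snd_mem_zero_one (by linarith) (by linarith)]
      ring_nf
    · refine ⟨0, -1, 0, 1, -1, 1, fun x h1 h2 => ?_⟩
      simp [transverse] at h1 h2 ⊢
      rw [courantHat_of_snd_mem_one_two (by linarith) (by linarith)]
      ring_nf
    · have hm' : (m : ℝ) + 1 ≤ 0 := by exact_mod_cast hm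
      refine hzero fun x h1 h2 => courantHat_eq_zero (Or.inr (Or.inl (le_abs.2 (Or.inr ?_))))
      simp [transverse] at h1 h2
      linarith
    · have hm' : (2 : ℝ) ≤ m := by exact_mod_cast hm
      refine hzero fun x h1 h2 => courantHat_eq_zero (Or.inr (Or.inl (le_abs.2 (Or.inl ?_))))
      simp [transverse] at h1 h2
      linarith
  · have hm : m = 0 ∨ m = 1 ∨ m + 1 ≤ 0 ∨ 2 ≤ m := by omega
    rcases hm with rfl | rfl | hm | hm
    · refine ⟨-1, 1, 0, 1, 1, 0, fun x h1 h2 => ?_⟩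
      simp [transverse] at h1 h2 ⊢
      rw [courantHat_of_fst_mem_zero_one (by linarith) (by linarith)]
      ring_nf
    · refine ⟨1, -1, 0, -1, 0, -1, fun x h1 h2 => ?_⟩
      simp [transverse] at h1 h2 ⊢
      rw [courantHat_of_fst_mem_one_two (by linarith) (by linarith)]
      ring_nf
    · have hm' : (m : ℝ) + 1 ≤ 0 := by exact_mod_cast hm
      refine hzero fun x h1 h2 => courantHat_eq_zero (Or.inl (le_abs.2 (Or.inr ?_)))
      simp [transverse] at h1 h2
      linarith
    · have hm' : (2 : ℝ) ≤ m := by exact_mod_cast hm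
      refine hzero fun x h1 h2 => courantHat_eq_zero (Or.inl (le_abs.2 (Or.inl ?_)))
      simp [transverse] at h1 h2
      linarith
  · have hm : m = 0 ∨ m = -1 ∨ m + 1 ≤ -1 ∨ 1 ≤ m := by omega
    rcases hm with rfl | rfl | hm | hm
    · refine ⟨0, 1, 0, -1, 0, -1, fun x h1 h2 => ?_⟩
      simp [transverse] at h1 h2 ⊢
      rw [courantHat_of_sub_mem_zero_one (by linarith) (by linarith)]
      ring_nf
    · refine ⟨0, -1, 0, 1, -1, 0, fun x h1 h2 => ?_⟩
      simp [transverse] at h1 h2 ⊢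
      rw [courantHat_of_sub_mem_neg_one_zero (by linarith) (by linarith)]
      ring_nf
    · have hm' : (m : ℝ) + 1 ≤ -1 := by exact_mod_cast hm
      refine hzero fun x h1 h2 => courantHat_eq_zero (Or.inr (Or.inr (le_abs.2 (Or.inr ?_))))
      simp [transverse] at h1 h2
      linarith
    · have hm' : (1 : ℝ) ≤ m := by exact_mod_cast hm
      refine hzero fun x h1 h2 => courantHat_eq_zero (Or.inr (Or.inr (le_abs.2 (Or.inl ?_))))
      simp [transverse] at h1 h2
      linarith

/-- A triangle lies between consecutive grid lines of each of the three directions. -/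
theorem exists_strip (T : GridTriangle) (i : Fin 3) :
    ∃ m : ℤ, ∀ x ∈ T.carrier, m ≤ transverse i x ∧ transverse i x ≤ m + 1 := by
  obtain ⟨v, u⟩ := T
  refine ⟨![v 1, v 0, v 0 - v 1 - (if u then 1 else 0)] i, fun x hx => ?_⟩
  rw [mem_carrier] at hx
  fin_cases i <;> cases u <;> simp [transverse] at hx ⊢ <;> constructor <;> linarith

theorem courantHat_sub_eq_affine (T : GridTriangle) (v : Fin 2 → ℤ) :
    ∃ α β γ : ℝ, ∀ x ∈ T.carrier, courantHat (x - latticePoint v) = α + β * x 0 + γ * x 1 := by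
  obtain ⟨m, hm⟩ := exists_strip T 0
  obtain ⟨m₁, hm₁⟩ := exists_strip T 1
  obtain ⟨m₂, hm₂⟩ := exists_strip T 2
  obtain ⟨κ, σ, κ', σ', a, b, h⟩ := courantHat_eq_on_strip 0 (m - v 1)
  obtain ⟨p, q, hpq⟩ := exists_ramp_eq_affine (m₁ - v 0 + a)
  obtain ⟨p', q', hpq'⟩ := exists_ramp_eq_affine (m₂ - (v 0 - v 1) + b)
  refine ⟨κ + σ * p + κ' + σ' * p' + σ * q * (a - v 0) + σ' * q' * (b - v 0 + v 1),
    σ * q + σ' * q', - (σ' * q'), fun x hx => ?_⟩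
  have h0 := hm x hx
  have h1 := hm₁ x hx
  have h2 := hm₂ x hx
  simp only [transverse, Matrix.cons_val] at h0 h1 h2
  rw [h _ (by simp [transverse]; linarith) (by simp [transverse]; linarith),
    hpq _ (by simp [transverse]; linarith) (by simp [transverse]; linarith),
    hpq' _ (by simp [transverse]; linarith) (by simp [transverse]; linarith)]
  simp [transverse]
  ring

/-- On every strip between consecutive grid lines parallel to `dir i`, the function is a sum of two
continuous functions, each constant along one of the other two directions. -/
def IsStripSum (i : Fin 3) (f : Plane → ℝ) : Prop :=
  ∀ m : ℤ, ∃ g h : ℝ → ℝ, Continuous g ∧ Continuous h ∧ ∀ x : Plane,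
    m ≤ transverse i x → transverse i x ≤ m + 1 →
      f x = g (transverse (i + 1) x) + h (transverse (i + 2) x)

theorem isStripSum_courantHat (i : Fin 3) : IsStripSum i courantHat := fun m => by
  obtain ⟨κ, σ, κ', σ', a, b, h⟩ := courantHat_eq_on_strip i m
  have := continuous_ramp
  exact ⟨fun u => κ + σ * ramp (u + a), fun u => κ' + σ' * ramp (u + b), by fun_prop, by fun_prop,
    h⟩

theorem IsStripSum.average {i : Fin 3} {f : Plane → ℝ} (hf : IsStripSum i f) :
    IsStripSum i (average (dir i) f) := fun m => by
  obtain ⟨g, h, hg, hh, hgh⟩ := hf m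
  refine ⟨fun u => ∫ t in (0 : ℝ)..1, g (u - t * transverse (i + 1) (dir i)),
    fun u => ∫ t in (0 : ℝ)..1, h (u - t * transverse (i + 2) (dir i)), ?_, ?_, fun x h1 h2 => ?_⟩
  · apply intervalIntegral.continuous_parametric_intervalIntegral_of_continuous'; fun_prop
  · apply intervalIntegral.continuous_parametric_intervalIntegral_of_continuous'; fun_prop
  · rw [TypeIBoxSpline.average, ← intervalIntegral.integral_add
      (Continuous.intervalIntegrable (by fun_prop) _ _)
      (Continuous.intervalIntegrable (by fun_prop) _ _)]
    refine intervalIntegral.integral_congr fun t _ => ?_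
    have ht : transverse i (x - t • dir i) = transverse i x := by
      rw [transverse_sub_smul, transverse_dir_self, mul_zero, sub_zero]
    rw [hgh _ (ht ▸ h1) (ht ▸ h2), transverse_sub_smul, transverse_sub_smul]

theorem isStripSum_boxSpline (i : Fin 3) (k : ℕ) :
    IsStripSum i (boxSpline (1 + Pi.single i k)) := by
  induction k with
  | zero => rw [Pi.single_zero, add_zero, boxSpline_one]; exact isStripSum_courantHat i
  | succ k ih =>
    have h : boxSpline (1 + Pi.single i k + Pi.single i 1) =
        average (dir i) (boxSpline (1 + Pi.single i k)) :=
      funext (boxSpline_add_single (1 + Pi.single i k) (fun j => by simp) i)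
    rw [Pi.single_add, ← add_assoc, h]
    exact ih.average

/-- A polynomial that coincides with a strip sum on a triangle is annihilated by the mixed
derivative along the other two directions. -/
theorem dirDeriv_dirDeriv_eq_zero_of_isStripSum {i : Fin 3} {f : Plane → ℝ} (hf : IsStripSum i f)
    (v : Fin 2 → ℤ) {T : GridTriangle} {p : MvPolynomial (Fin 2) ℝ}
    (hp : ∀ x ∈ T.carrier, eval x p = f (x - latticePoint v)) :
    dirDeriv (i + 1) (dirDeriv (i + 2) p) = 0 := by
  obtain ⟨m, hm⟩ := exists_strip T i
  obtain ⟨g, h, -, -, hgh⟩ := hf (m - transverse i v)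
  have key : ∀ x ∈ T.carrier, eval x p = g (transverse (i + 1) x - (transverse (i + 1) v : ℤ)) +
      h (transverse (i + 2) x - (transverse (i + 2) v : ℤ)) := fun x hx => by
    have := hm x hx
    rw [hp x hx, hgh, transverse_sub, transverse_sub, transverse_latticePoint,
      transverse_latticePoint] <;> rw [transverse_sub, transverse_latticePoint] <;>
      push_cast <;> linarith
  clear hgh hm hp hf
  set U := Set.pi Set.univ T.box
  -- A point stays in the open set `U` under small displacements.
  have hnear : ∀ x ∈ U, ∀ j : Fin 3, ∀ᶠ s : ℝ in nhds 0, x + s • dir j ∈ U := fun x hx j => by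
    have hcont : Continuous fun s : ℝ => x + s • dir j := by fun_prop
    exact hcont.continuousAt.eventually_mem
      ((isOpen_pi_box T).mem_nhds (by rwa [zero_smul, add_zero]))
  -- The derivative of `p` along `dir (i + 2)` is locally constant along `dir (i + 1)`.
  have hstep : ∀ x ∈ U, ∀ t : ℝ, x + t • dir (i + 1) ∈ U →
      eval (x + t • dir (i + 1)) (dirDeriv (i + 2) p) = eval x (dirDeriv (i + 2) p) := by
    intro x hx t hxt
    have d1 := hasDerivAt_eval (i + 2) p (x + t • dir (i + 1)) 0
    have d2 := hasDerivAt_eval (i + 2) p x 0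
    have d3 := d1.sub d2
    have hconst : (fun s : ℝ => eval (x + t • dir (i + 1) + s • dir (i + 2)) p) -
        (fun s : ℝ => eval (x + s • dir (i + 2)) p) =ᶠ[nhds 0]
        fun _ => h (transverse (i + 2) (x + t • dir (i + 1)) - (transverse (i + 2) v : ℤ)) -
          h (transverse (i + 2) x - (transverse (i + 2) v : ℤ)) := by
      filter_upwards [hnear x hx (i + 2), hnear _ hxt (i + 2)] with s hs hst
      rw [Pi.sub_apply, key _ (pi_box_subset T hs), key _ (pi_box_subset T hst)]
      simp only [transverse_add_smul, transverse_dir_self]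
      ring_nf
    have d4 := d3.unique ((hasDerivAt_const (0 : ℝ) _).congr_of_eventuallyEq hconst)
    simpa [sub_eq_zero] using d4
  refine eq_of_eval_eq_on_box (T := T) fun x hx => ?_
  have d1 := hasDerivAt_eval (i + 1) (dirDeriv (i + 2) p) x 0
  have hconst : (fun s : ℝ => eval (x + s • dir (i + 1)) (dirDeriv (i + 2) p)) =ᶠ[nhds 0]
      fun _ => eval x (dirDeriv (i + 2) p) := by
    filter_upwards [hnear x hx (i + 1)] with s hs using hstep x hx s hs
  simpa using d1.unique ((hasDerivAt_const (0 : ℝ) _).congr_of_eventuallyEq hconst)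

/-! ### Splines with arbitrary coefficients -/

theorem exists_eq_add_single {n : Fin 3 → ℕ} (hn : ∀ j, 1 ≤ n j) {i : Fin 3} (hi : 2 ≤ n i) :
    ∃ m : Fin 3 → ℕ, (∀ j, 1 ≤ m j) ∧ n = m + Pi.single i 1 := by
  refine ⟨n - Pi.single i 1, fun j => ?_, ?_⟩
  · by_cases hj : j = i
    · subst hj; simp; omega
    · simpa [hj] using hn j
  · ext j
    by_cases hj : j = i
    · subst hj; simp; omega
    · simp [hj]

/-- Induction on the multiplicities, one convolution step at a time. -/
theorem multiplicity_induction {P : (Fin 3 → ℕ) → Prop} (h1 : P 1)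
    (hs : ∀ n i, (∀ j, 1 ≤ n j) → P n → P (n + Pi.single i 1)) :
    ∀ n, (∀ j, 1 ≤ n j) → P n := by
  intro n
  induction h : ∑ j, n j using Nat.strong_induction_on generalizing n with
  | _ N ih =>
    intro hn
    by_cases hex : ∃ i, 2 ≤ n i
    · obtain ⟨i, hi⟩ := hex
      obtain ⟨m, hm, rfl⟩ := exists_eq_add_single hn hi
      refine hs m i hm (ih (∑ j, m j) ?_ m rfl hm)
      rw [← h]
      simp [Finset.sum_add_distrib]
    · push Not at hex
      rwa [show n = 1 from funext fun j => by
        have := hn j; have := hex j; simp; omega]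

theorem boxSpline_eq_average (n : Fin 3 → ℕ) (hn : ∀ i, 1 ≤ n i) (i : Fin 3) :
    boxSpline (n + Pi.single i 1) = average (dir i) (boxSpline n) :=
  funext (boxSpline_add_single n hn i)

theorem abs_dir_le (i : Fin 3) (k : Fin 2) : |dir i k| ≤ 1 := by
  fin_cases i <;> fin_cases k <;> simp

theorem abs_sub_smul_dir_le {x : Plane} {r t : ℝ} (hx : ∀ k, |x k| ≤ r) (h0 : 0 ≤ t) (h1 : t ≤ 1)
    (i : Fin 3) (k : Fin 2) : |(x - t • dir i) k| ≤ r + 1 := by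
  refine (abs_sub _ _).trans (add_le_add (hx k) ?_)
  rw [Pi.smul_apply, smul_eq_mul, abs_mul, abs_of_nonneg h0]
  exact mul_le_one₀ h1 (abs_nonneg _) (abs_dir_le i k)

theorem exists_boxSpline_eq_zero (n : Fin 3 → ℕ) (hn : ∀ i, 1 ≤ n i) :
    ∃ r : ℝ, ∀ x : Plane, ∀ k, r < |x k| → boxSpline n x = 0 := by
  refine multiplicity_induction (P := fun n => ∃ r : ℝ, ∀ x : Plane, ∀ k, r < |x k| →
    boxSpline n x = 0) ⟨2, fun x k hk => ?_⟩ (fun n i hn ⟨r, hr⟩ => ⟨r + 1, fun x k hk => ?_⟩) n hn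
  · have h1 : 1 ≤ |x k - 1| := by
      have := abs_sub_abs_le_abs_sub (x k) 1
      rw [abs_one] at this; linarith
    rw [boxSpline_one]
    fin_cases k
    · exact courantHat_eq_zero (Or.inl h1)
    · exact courantHat_eq_zero (Or.inr (Or.inl h1))
  · rw [boxSpline_eq_average n hn, average]
    refine (intervalIntegral.integral_congr (g := fun _ => (0 : ℝ)) fun t ht => hr _ k ?_).trans
      intervalIntegral.integral_zero
    rw [Set.uIcc_of_le zero_le_one] at ht
    by_contra! hcon
    have h2 : |x k| ≤ |(x - t • dir i) k| + |t * dir i k| := by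
      simpa using abs_add_le ((x - t • dir i) k) (t * dir i k)
    have h3 : |t * dir i k| ≤ 1 := by
      rw [abs_mul, abs_of_nonneg ht.1]
      exact mul_le_one₀ ht.2 (abs_nonneg _) (abs_dir_le i k)
    linarith

/-- Only finitely many translates of a box spline are nonzero on a bounded region. -/
theorem exists_finset_translates (n : Fin 3 → ℕ) (hn : ∀ i, 1 ≤ n i) (r : ℝ) :
    ∃ A : Finset (Fin 2 → ℤ), ∀ x : Plane, (∀ k, |x k| ≤ r) → ∀ v ∉ A,
      boxSpline n (x - latticePoint v) = 0 := by
  obtain ⟨s, hs⟩ := exists_boxSpline_eq_zero n hn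
  refine ⟨Fintype.piFinset fun _ => Finset.Icc (-⌈r + s⌉) ⌈r + s⌉, fun x hx v hv => ?_⟩
  simp only [Fintype.mem_piFinset, Finset.mem_Icc, not_forall] at hv
  obtain ⟨k, hk⟩ := hv
  rw [← abs_le, not_le] at hk
  refine hs _ k ?_
  have h1 : r + s < |(v k : ℝ)| :=
    (Int.le_ceil _).trans_lt (by exact_mod_cast hk)
  have h2 := abs_sub_abs_le_abs_sub (v k : ℝ) (x k)
  rw [abs_sub_comm] at h2
  have h3 := hx k
  rw [Pi.sub_apply, latticePoint_apply]
  linarith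

/-- The spline `∑ c_v B_n(· - v)`, for an arbitrary family of coefficients; the sum is locally
finite. -/
def spline (n : Fin 3 → ℕ) (c : (Fin 2 → ℤ) → ℝ) (x : Plane) : ℝ :=
  ∑ᶠ v, c v * boxSpline n (x - latticePoint v)

theorem spline_eq_sum {n : Fin 3 → ℕ} {A : Finset (Fin 2 → ℤ)} {x : Plane}
    (h : ∀ v ∉ A, boxSpline n (x - latticePoint v) = 0) (c : (Fin 2 → ℤ) → ℝ) :
    spline n c x = ∑ v ∈ A, c v * boxSpline n (x - latticePoint v) :=
  finsum_eq_sum_of_support_subset _ fun v hv => by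
    by_contra hvA
    exact hv (by simp [h v hvA])

theorem spline_single (n : Fin 3 → ℕ) (v : Fin 2 → ℤ) (x : Plane) :
    spline n (Pi.single v 1) x = boxSpline n (x - latticePoint v) := by
  rw [spline, finsum_eq_single _ v fun w hw => by simp [hw]]
  simp

theorem abs_apply_le_norm (x : Plane) (k : Fin 2) : |x k| ≤ ‖x‖ := norm_le_pi_norm x k

theorem spline_add (n : Fin 3 → ℕ) (hn : ∀ i, 1 ≤ n i) (c d : (Fin 2 → ℤ) → ℝ) (x : Plane) :
    spline n (c + d) x = spline n c x + spline n d x := by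
  obtain ⟨A, hA⟩ := exists_finset_translates n hn ‖x‖
  have h := hA x (abs_apply_le_norm x)
  simp [spline_eq_sum h, add_mul, Finset.sum_add_distrib]

theorem spline_smul (n : Fin 3 → ℕ) (a : ℝ) (c : (Fin 2 → ℤ) → ℝ) (x : Plane) :
    spline n (a • c) x = a * spline n c x := by
  simp [spline, ← smul_eq_mul, smul_finsum]

theorem spline_sub (n : Fin 3 → ℕ) (hn : ∀ i, 1 ≤ n i) (c d : (Fin 2 → ℤ) → ℝ) (x : Plane) :
    spline n (c - d) x = spline n c x - spline n d x := by
  rw [eq_sub_iff_add_eq, ← spline_add n hn, sub_add_cancel]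

theorem continuous_spline (n : Fin 3 → ℕ) (hn : ∀ i, 1 ≤ n i) (c : (Fin 2 → ℤ) → ℝ) :
    Continuous (spline n c) := by
  refine continuous_iff_continuousAt.2 fun x => ?_
  obtain ⟨A, hA⟩ := exists_finset_translates n hn (‖x‖ + 1)
  have hB := continuous_boxSpline n
  have hc : Continuous fun y => ∑ v ∈ A, c v * boxSpline n (y - latticePoint v) := by fun_prop
  refine hc.continuousAt.congr ?_
  filter_upwards [Metric.ball_mem_nhds x one_pos] with y hy
  refine (spline_eq_sum (hA y fun k => (abs_apply_le_norm y k).trans ?_) c).symm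
  have := norm_sub_norm_le y x
  rw [mem_ball_iff_norm] at hy
  linarith

theorem spline_add_single (n : Fin 3 → ℕ) (hn : ∀ i, 1 ≤ n i) (i : Fin 3)
    (c : (Fin 2 → ℤ) → ℝ) :
    spline (n + Pi.single i 1) c = average (dir i) (spline n c) := by
  funext x
  obtain ⟨A, hA⟩ := exists_finset_translates n hn (‖x‖ + 1)
  have hB := continuous_boxSpline n
  have hA' : ∀ t ∈ Set.uIcc (0 : ℝ) 1, ∀ v ∉ A,
      boxSpline n (x - t • dir i - latticePoint v) = 0 := fun t ht => by
    rw [Set.uIcc_of_le zero_le_one] at ht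
    exact hA _ (abs_sub_smul_dir_le (abs_apply_le_norm x) ht.1 ht.2 i)
  rw [spline_eq_sum (A := A) (fun v hv => ?_), average,
    intervalIntegral.integral_congr fun t ht => spline_eq_sum (hA' t ht) c,
    intervalIntegral.integral_finsetSum
      fun v _ => Continuous.intervalIntegrable (by fun_prop) _ _]
  · refine Finset.sum_congr rfl fun v _ => ?_
    rw [boxSpline_eq_average n hn, average, ← intervalIntegral.integral_const_mul]
    simp only [sub_right_comm]
  · rw [boxSpline_eq_average n hn, average]
    refine (intervalIntegral.integral_congr (g := fun _ => (0 : ℝ)) fun t ht => ?_).trans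
      intervalIntegral.integral_zero
    simpa only [sub_right_comm] using hA' t ht v hv

/-- The direction `dir i` as a lattice vector. -/
def latticeDir : Fin 3 → Fin 2 → ℤ := ![![1, 0], ![0, 1], ![1, 1]]

theorem latticePoint_latticeDir (i : Fin 3) : latticePoint (latticeDir i) = dir i := by
  ext k; fin_cases i <;> fin_cases k <;> simp [latticeDir]

theorem spline_sub_dir (n : Fin 3 → ℕ) (c : (Fin 2 → ℤ) → ℝ) (i : Fin 3) (x : Plane) :
    spline n c (x - dir i) = spline n (fun v => c (v - latticeDir i)) x := by
  unfold spline
  rw [← finsum_comp_equiv (Equiv.subRight (latticeDir i))]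
  refine finsum_congr fun v => ?_
  rw [Equiv.subRight_apply, ← latticePoint_latticeDir]
  congr 2
  ext k; simp

/-- The backward difference of a coefficient family in the direction `dir i`. -/
def backDiff (i : Fin 3) (c : (Fin 2 → ℤ) → ℝ) : (Fin 2 → ℤ) → ℝ :=
  c - fun v => c (v - latticeDir i)

theorem spline_backDiff (n : Fin 3 → ℕ) (hn : ∀ i, 1 ≤ n i) (i : Fin 3) (c : (Fin 2 → ℤ) → ℝ)
    (x : Plane) : spline n (backDiff i c) x = spline n c x - spline n c (x - dir i) := by
  rw [backDiff, spline_sub n hn, spline_sub_dir]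

theorem hasDerivAt_average {f : Plane → ℝ} (hf : Continuous f) (e x : Plane) :
    HasDerivAt (fun s : ℝ => average e f (x + s • e)) (f x - f (x - e)) 0 := by
  have hc : Continuous fun u : ℝ => f (x + u • e) := by fun_prop
  have hF : ∀ s : ℝ,
      HasDerivAt (fun s : ℝ => ∫ u in (0 : ℝ)..s, f (x + u • e)) (f (x + s • e)) s :=
    fun s => hc.integral_hasStrictDerivAt 0 s |>.hasDerivAt
  have h1 := (hF 0).sub ((hF (0 - 1)).comp_sub_const 0 1)
  have h2 : (fun s : ℝ => average e f (x + s • e)) =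
      (fun s : ℝ => ∫ u in (0 : ℝ)..s, f (x + u • e)) -
        fun s : ℝ => ∫ u in (0 : ℝ)..(s - 1), f (x + u • e) := by
    funext s
    rw [Pi.sub_apply, intervalIntegral.integral_interval_sub_left (hc.intervalIntegrable _ _)
      (hc.intervalIntegrable _ _), average]
    have := intervalIntegral.integral_comp_sub_left (a := 0) (b := 1)
      (fun u : ℝ => f (x + u • e)) s
    rw [sub_zero] at this
    rw [← this]
    refine intervalIntegral.integral_congr fun t _ => ?_
    simp only [sub_smul, add_sub_assoc]
  rw [h2]
  simpa [sub_eq_add_neg] using h1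

/-- Differentiation of the polynomial pieces: the derivative along `dir i` undoes a convolution step
and takes the backward difference of the coefficients. -/
theorem dirDeriv_eq_of_spline {n : Fin 3 → ℕ} (hn : ∀ i, 1 ≤ n i) {i : Fin 3}
    {c : (Fin 2 → ℤ) → ℝ} {T : GridTriangle} {p q : MvPolynomial (Fin 2) ℝ}
    (hp : ∀ x ∈ T.carrier, eval x p = spline (n + Pi.single i 1) c x)
    (hq : ∀ x ∈ T.carrier, eval x q = spline n (backDiff i c) x) : dirDeriv i p = q := by
  refine eq_of_eval_eq_on_box (T := T) fun x hx => ?_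
  have h1 := hasDerivAt_average (continuous_spline n hn c) (dir i) x
  have h2 := hasDerivAt_eval i p x 0
  have h3 : (fun s : ℝ => eval (x + s • dir i) p) =ᶠ[nhds 0]
      fun s : ℝ => average (dir i) (spline n c) (x + s • dir i) := by
    have hcont : Continuous fun s : ℝ => x + s • dir i := by fun_prop
    filter_upwards [hcont.continuousAt.eventually_mem
      ((isOpen_pi_box T).mem_nhds (x := x + (0 : ℝ) • dir i) (by rwa [zero_smul, add_zero]))]
      with s hs
    rw [hp _ (pi_box_subset T hs), spline_add_single n hn]
  rw [hq x (pi_box_subset T hx), spline_backDiff n hn, ← h2.unique (h1.congr_of_eventuallyEq h3),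
    zero_smul, add_zero]

theorem exists_finset_translates_carrier (n : Fin 3 → ℕ) (hn : ∀ i, 1 ≤ n i)
    (T : GridTriangle) :
    ∃ A : Finset (Fin 2 → ℤ), ∀ x ∈ T.carrier, ∀ v ∉ A,
      boxSpline n (x - latticePoint v) = 0 := by
  obtain ⟨A, hA⟩ := exists_finset_translates n hn
    (|(T.corner 0 : ℝ)| + |(T.corner 1 : ℝ)| + 1)
  refine ⟨A, fun x hx => hA x fun k => ?_⟩
  obtain ⟨v, u⟩ := T
  rw [mem_carrier] at hx
  have a0 := neg_abs_le (v 0 : ℝ)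
  have a1 := neg_abs_le (v 1 : ℝ)
  have b0 := le_abs_self (v 0 : ℝ)
  have b1 := le_abs_self (v 1 : ℝ)
  rw [abs_le]
  fin_cases k <;> cases u <;> simp at hx ⊢ <;> constructor <;> linarith

theorem exists_spline_one_eq_affine (c : (Fin 2 → ℤ) → ℝ) (T : GridTriangle) :
    ∃ α β γ : ℝ, ∀ x ∈ T.carrier, spline 1 c x = α + β * x 0 + γ * x 1 := by
  obtain ⟨A, hA⟩ := exists_finset_translates_carrier 1 (fun _ => le_rfl) T
  choose α β γ h using courantHat_sub_eq_affine T
  refine ⟨∑ v ∈ A, c v * α v, ∑ v ∈ A, c v * β v, ∑ v ∈ A, c v * γ v, fun x hx => ?_⟩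
  rw [spline_eq_sum (hA x hx)]
  simp_rw [Finset.sum_mul, ← Finset.sum_add_distrib]
  refine Finset.sum_congr rfl fun v _ => ?_
  rw [boxSpline_one, h v x hx]; ring

/-! ### Polynomial pieces of splines -/

theorem isPiecewisePolynomial_spline (n : Fin 3 → ℕ) (hn : ∀ i, 1 ≤ n i)
    (c : (Fin 2 → ℤ) → ℝ) : IsPiecewisePolynomial (n 0 + n 1 + n 2 - 2) (spline n c) := by
  refine multiplicity_induction (P := fun n => IsPiecewisePolynomial (n 0 + n 1 + n 2 - 2)
    (spline n c)) (fun T => ?_) (fun n i hn ih => ?_) n hn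
  · obtain ⟨α, β, γ, h⟩ := exists_spline_one_eq_affine c T
    exact ⟨affinePoly α β γ, totalDegree_affinePoly α β γ, fun x hx => by
      rw [eval_affinePoly, h x hx]⟩
  · have h0 := hn 0
    have h1 := hn 1
    have hdeg : (n + Pi.single i 1 : Fin 3 → ℕ) 0 + (n + Pi.single i 1 : Fin 3 → ℕ) 1 +
        (n + Pi.single i 1 : Fin 3 → ℕ) 2 - 2 =
        n 0 + n 1 + n 2 - 2 + 1 := by
      fin_cases i <;> simp <;> omega
    rw [hdeg, spline_add_single n hn]
    exact isPiecewisePolynomial_average (continuous_spline n hn c) ih i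

theorem exists_polynomial_eq_spline (n : Fin 3 → ℕ) (hn : ∀ i, 1 ≤ n i) (c : (Fin 2 → ℤ) → ℝ)
    (T : GridTriangle) : ∃ p : MvPolynomial (Fin 2) ℝ, ∀ x ∈ T.carrier, eval x p = spline n c x :=
  let ⟨p, _, hp⟩ := isPiecewisePolynomial_spline n hn c T
  ⟨p, hp⟩

theorem spline_one_latticePoint (c : (Fin 2 → ℤ) → ℝ) (w : Fin 2 → ℤ) :
    spline 1 c (latticePoint w) = c (w - ![1, 1]) := by
  have h : ∀ v, latticePoint w - latticePoint v = latticePoint (w - v) := fun v => by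
    ext k; simp
  rw [spline, finsum_eq_single _ (w - ![1, 1])]
  · rw [h, sub_sub_cancel, boxSpline_one,
      show latticePoint ![1, 1] = ![1, 1] by ext k; fin_cases k <;> simp, courantHat_one_one,
      mul_one]
  · intro v hv
    rw [h, boxSpline_one, courantHat_latticePoint _ fun h' => hv ?_, mul_zero]
    rw [← h', sub_sub_cancel]

/-- The grid triangles cover the plane. -/
theorem exists_mem_carrier (x : Plane) : ∃ T : GridTriangle, x ∈ T.carrier := by
  have h0 := Int.floor_le (x 0)
  have h1 := Int.floor_le (x 1)
  have h2 := (Int.lt_floor_add_one (x 0)).le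
  have h3 := (Int.lt_floor_add_one (x 1)).le
  rcases le_total (x 0 - ⌊x 0⌋) (x 1 - ⌊x 1⌋) with h | h
  · refine ⟨⟨![⌊x 0⌋, ⌊x 1⌋], true⟩, (mem_carrier _ _ _).2 ?_⟩
    refine ⟨?_, ?_, ?_⟩ <;> simp only [Matrix.cons_val] <;> linarith
  · refine ⟨⟨![⌊x 0⌋, ⌊x 1⌋], false⟩, (mem_carrier _ _ _).2 ?_⟩
    refine ⟨?_, ?_, ?_⟩ <;> simp only [Matrix.cons_val] <;> linarith

theorem spline_one_affine (a b k : ℝ) (x : Plane) :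
    spline 1 (fun v => a * v 0 + b * v 1 + k) x = a * (x 0 - 1) + b * (x 1 - 1) + k := by
  obtain ⟨⟨v, u⟩, hx⟩ := exists_mem_carrier x
  obtain ⟨α, β, γ, h⟩ :=
    exists_spline_one_eq_affine (fun v => a * v 0 + b * v 1 + k) ⟨v, u⟩
  have hv : ∀ w : Fin 2 → ℤ, latticePoint w ∈ (GridTriangle.mk v u).carrier →
      a * (w 0 - 1) + b * (w 1 - 1) + k = α + β * w 0 + γ * w 1 := fun w hw => by
    have := h _ hw
    rw [spline_one_latticePoint] at this
    simpa using this
  -- Both sides are affine on the triangle, so that it suffices to compare them at the vertices.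
  have e0 := hv v (by rw [mem_carrier]; cases u <;> simp)
  have e3 := hv ![v 0 + 1, v 1 + 1] (by rw [mem_carrier]; cases u <;> simp)
  rw [h x hx]
  cases u
  · have e1 := hv ![v 0 + 1, v 1] (by rw [mem_carrier]; simp)
    simp at e0 e1 e3
    obtain rfl : β = a := by linarith
    obtain rfl : γ = b := by linarith
    linarith
  · have e1 := hv ![v 0, v 1 + 1] (by rw [mem_carrier]; simp)
    simp at e0 e1 e3
    obtain rfl : β = a := by linarith
    obtain rfl : γ = b := by linarith
    linarith

/-- Box splines reproduce linear polynomials, up to a shift of the argument that depends only on the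
multiplicities. -/
theorem exists_spline_affine (n : Fin 3 → ℕ) (hn : ∀ i, 1 ≤ n i) :
    ∃ τ : Plane, ∀ (a b k : ℝ) (x : Plane),
      spline n (fun v => a * v 0 + b * v 1 + k) x = a * (x 0 - τ 0) + b * (x 1 - τ 1) + k := by
  refine multiplicity_induction (P := fun n => ∃ τ : Plane, ∀ (a b k : ℝ) (x : Plane),
    spline n (fun v => a * v 0 + b * v 1 + k) x = a * (x 0 - τ 0) + b * (x 1 - τ 1) + k)
    ⟨fun _ => 1, spline_one_affine⟩ (fun n i hn ⟨τ, hτ⟩ => ?_) n hn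
  refine ⟨τ + (1 / 2 : ℝ) • dir i, fun a b k x => ?_⟩
  rw [spline_add_single n hn, average]
  simp only [hτ]
  have : ∀ t : ℝ, a * ((x - t • dir i) 0 - τ 0) + b * ((x - t • dir i) 1 - τ 1) + k =
      (a * (x 0 - τ 0) + b * (x 1 - τ 1) + k) - t * (a * dir i 0 + b * dir i 1) := fun t => by
    simp; ring
  simp only [this]
  rw [intervalIntegral.integral_sub (Continuous.intervalIntegrable (by fun_prop) _ _)
    (Continuous.intervalIntegrable (by fun_prop) _ _), intervalIntegral.integral_const,
    intervalIntegral.integral_mul_const, integral_id]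
  simp; ring

theorem spline_const (n : Fin 3 → ℕ) (hn : ∀ i, 1 ≤ n i) (k : ℝ) (x : Plane) :
    spline n (fun _ => k) x = k := by
  obtain ⟨τ, h⟩ := exists_spline_affine n hn
  simpa using h 0 0 k x

/-- Inactive translates vanish on the triangle, so that the span of the active ones consists of the
restrictions of all splines. -/
theorem mem_activeSpan {n : Fin 3 → ℕ} (hn : ∀ i, 1 ≤ n i) {T : GridTriangle}
    {f : T.carrier → ℝ} : f ∈ activeSpan n T ↔ ∃ c, ∀ x : T.carrier, f x = spline n c x := by
  constructor
  · intro hf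
    induction hf using Submodule.span_induction with
    | mem f hf =>
      obtain ⟨v, -, rfl⟩ := hf
      exact ⟨Pi.single v 1, fun x => by rw [spline_single]; rfl⟩
    | zero => exact ⟨0, fun x => by simp [spline]⟩
    | add f g _ _ hf hg =>
      obtain ⟨c, hc⟩ := hf
      obtain ⟨d, hd⟩ := hg
      exact ⟨c + d, fun x => by rw [spline_add n hn, ← hc, ← hd]; rfl⟩
    | smul a f _ hf =>
      obtain ⟨c, hc⟩ := hf
      exact ⟨a • c, fun x => by rw [spline_smul, ← hc]; rfl⟩
  · rintro ⟨c, hc⟩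
    obtain ⟨A, hA⟩ := exists_finset_translates_carrier n hn T
    have hf : f = ∑ v ∈ A, c v • fun x : T.carrier => boxSplineTranslate n v x := by
      ext x
      rw [hc x, spline_eq_sum (hA x x.2)]
      simp [boxSplineTranslate]
    rw [hf]
    refine Submodule.sum_mem _ fun v _ => Submodule.smul_mem _ _ ?_
    by_cases hv : v ∈ activeShifts n T
    · exact Submodule.subset_span ⟨v, hv, rfl⟩
    · have h0 : (fun x : T.carrier => boxSplineTranslate n v x) = 0 := by
        ext x
        by_contra hx
        exact hv ⟨x, hx, x.2⟩
      rw [h0]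
      exact Submodule.zero_mem _

theorem mem_polySpace {n : Fin 3 → ℕ} (hn : ∀ i, 1 ≤ n i) {T : GridTriangle}
    {p : MvPolynomial (Fin 2) ℝ} :
    p ∈ polySpace n T ↔ ∃ c, ∀ x ∈ T.carrier, eval x p = spline n c x := by
  rw [polySpace, Submodule.mem_comap, mem_activeSpan hn]
  exact exists_congr fun c => ⟨fun h x hx => h ⟨x, hx⟩, fun h x => h x x.2⟩

theorem map_polySpace {n : Fin 3 → ℕ} (hn : ∀ i, 1 ≤ n i) (T : GridTriangle) :
    (polySpace n T).map (polyRestrict T) = activeSpan n T := by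
  refine le_antisymm (Submodule.map_comap_le _ _) fun f hf => ?_
  obtain ⟨c, hc⟩ := (mem_activeSpan hn).1 hf
  obtain ⟨p, hp⟩ := exists_polynomial_eq_spline n hn c T
  exact ⟨p, (mem_polySpace hn).2 ⟨c, hp⟩, funext fun x => (hp x x.2).trans (hc x).symm⟩

theorem polySpace_le_restrictTotalDegree {n : Fin 3 → ℕ} (hn : ∀ i, 1 ≤ n i) (T : GridTriangle) :
    polySpace n T ≤ restrictTotalDegree (Fin 2) ℝ (n 0 + n 1 + n 2 - 2) := fun p hp => by
  obtain ⟨c, hc⟩ := (mem_polySpace hn).1 hp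
  obtain ⟨q, hqd, hq⟩ := isPiecewisePolynomial_spline n hn c T
  obtain rfl : p = q := eq_of_eval_eq_on_box (T := T) fun x hx => by
    rw [hc x (pi_box_subset T hx), hq x (pi_box_subset T hx)]
  exact (mem_restrictTotalDegree _ _ _).2 hqd

/-- Spline pieces are annihilated by the mixed derivative `D_j D_k` if `n_j = n_k = 1`. -/
theorem dirDeriv_dirDeriv_eq_zero {n : Fin 3 → ℕ} (hn : ∀ i, 1 ≤ n i) {i : Fin 3}
    (h1 : n (i + 1) = 1) (h2 : n (i + 2) = 1) {T : GridTriangle} {p : MvPolynomial (Fin 2) ℝ}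
    (hp : p ∈ polySpace n T) : dirDeriv (i + 1) (dirDeriv (i + 2) p) = 0 := by
  obtain ⟨c, hc⟩ := (mem_polySpace hn).1 hp
  obtain ⟨A, hA⟩ := exists_finset_translates_carrier n hn T
  choose q hq using fun v => exists_polynomial_eq_spline n hn (Pi.single v 1) T
  have hpq : p = ∑ v ∈ A, c v • q v := eq_of_eval_eq_on_box (T := T) fun x hx => by
    have hx' := pi_box_subset T hx
    rw [hc x hx', spline_eq_sum (hA x hx')]
    simp [hq _ x hx', spline_single]
  have hn' : n = 1 + Pi.single i (n i - 1) := by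
    have := hn i
    ext j
    obtain ⟨g1, g2, g3⟩ := add_ne_self i
    rcases eq_or_eq_add i j with rfl | rfl | rfl
    · simp; omega
    · simp [h1, g1]
    · simp [h2, g2]
  simp only [hpq, map_sum, map_smul]
  refine Finset.sum_eq_zero fun v _ => ?_
  rw [dirDeriv_dirDeriv_eq_zero_of_isStripSum (f := boxSpline n) (v := v) (T := T)
    (by rw [hn']; exact isStripSum_boxSpline i _) fun x hx => by rw [hq v x hx, spline_single],
    smul_zero]

theorem dirDeriv_mem_polySpace {n : Fin 3 → ℕ} (hn : ∀ i, 1 ≤ n i) {i : Fin 3}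
    {T : GridTriangle} {p : MvPolynomial (Fin 2) ℝ} (hp : p ∈ polySpace (n + Pi.single i 1) T) :
    dirDeriv i p ∈ polySpace n T := by
  have hn' : ∀ j, 1 ≤ (n + Pi.single i 1 : Fin 3 → ℕ) j := fun j =>
    (hn j).trans (Nat.le_add_right _ _)
  obtain ⟨c, hc⟩ := (mem_polySpace hn').1 hp
  obtain ⟨q, hq⟩ := exists_polynomial_eq_spline n hn (backDiff i c) T
  rw [dirDeriv_eq_of_spline hn hc hq]
  exact (mem_polySpace hn).2 ⟨_, hq⟩

theorem polySpace_le_derivKernel {n : Fin 3 → ℕ} (hn : ∀ i, 1 ≤ n i) (T : GridTriangle) :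
    polySpace n T ≤ derivKernel n := fun p hp => mem_derivKernel.2 fun i => by
  obtain ⟨g1, g2, g3⟩ := add_ne_self i
  induction h : n (i + 1) + n (i + 2) using Nat.strong_induction_on generalizing n p with
  | _ N ih =>
    by_cases h1 : 2 ≤ n (i + 1)
    · obtain ⟨m, hm, rfl⟩ := exists_eq_add_single hn h1
      have := ih _ (by rw [← h]; simp) hm (dirDeriv (i + 1) p) (dirDeriv_mem_polySpace hm hp) rfl
      rw [← Module.End.mul_apply (dirDeriv (i + 2) ^ _),
        ((commute_dirDeriv (i + 2) (i + 1)).pow_left _).eq, Module.End.mul_apply,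
        ← Module.End.mul_apply, ← pow_succ] at this
      simpa [g3.symm] using this
    by_cases h2 : 2 ≤ n (i + 2)
    · obtain ⟨m, hm, rfl⟩ := exists_eq_add_single hn h2
      have := ih _ (by rw [← h]; simp) hm (dirDeriv (i + 2) p) (dirDeriv_mem_polySpace hm hp) rfl
      simpa [g3, pow_succ] using this
    have e1 : n (i + 1) = 1 := by have := hn (i + 1); omega
    have e2 : n (i + 2) = 1 := by have := hn (i + 2); omega
    rw [e1, e2, pow_one, pow_one]
    exact dirDeriv_dirDeriv_eq_zero hn e1 e2 hp

/-! ### Backward differences of coefficient families -/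

/-- Every two-sided sequence is the backward difference of another one. -/
theorem exists_sub_shift_eq (c : ℤ → ℝ) : ∃ d : ℤ → ℝ, ∀ m, d m - d (m - 1) = c m := by
  refine ⟨fun m => ∑ k ∈ Finset.Ioc 0 m, c k - ∑ k ∈ Finset.Ioc m 0, c k, fun m => ?_⟩
  beta_reduce
  rcases le_or_gt m 0 with h | h
  · have h1 : Finset.Ioc (m - 1) 0 = insert m (Finset.Ioc m 0) := by ext; simp; omega
    rw [h1, Finset.sum_insert (by simp), Finset.Ioc_eq_empty_of_le h,
      Finset.Ioc_eq_empty_of_le (by omega : m - 1 ≤ 0), Finset.sum_empty]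
    ring
  · have h1 : Finset.Ioc 0 m = insert m (Finset.Ioc 0 (m - 1)) := by ext; simp; omega
    rw [h1, Finset.sum_insert (by simp), Finset.Ioc_eq_empty_of_le (by omega : (0 : ℤ) ≤ m),
      Finset.Ioc_eq_empty_of_le (by omega : (0 : ℤ) ≤ m - 1)]
    ring

theorem backDiff_surjective (i : Fin 3) : Function.Surjective (backDiff i) := fun c => by
  -- The position of a lattice point on its grid line in the direction `dir i`.
  let pos : (Fin 2 → ℤ) → ℤ := fun v => ![v 0, v 1, v 0] i
  have hpos : ∀ v, pos (v - latticeDir i) = pos v - 1 := fun v => by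
    fin_cases i <;> rfl
  choose D hD using exists_sub_shift_eq
  refine ⟨fun v => D (fun m => c (v - (pos v - m) • latticeDir i)) (pos v), funext fun v => ?_⟩
  have hline : (fun m : ℤ => c (v - latticeDir i - (pos v - 1 - m) • latticeDir i)) =
      fun m => c (v - (pos v - m) • latticeDir i) := funext fun m => by
    congr 1; module
  rw [backDiff, Pi.sub_apply, hpos, hline, hD]
  simp

theorem exists_backDiff_comp_transverse {i j : Fin 3} (h : j ≠ i) (c : ℤ → ℝ) :
    ∃ d : ℤ → ℝ, backDiff j (fun v => d (transverse i v)) = fun v => c (transverse i v) := by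
  obtain ⟨d, hd⟩ := exists_sub_shift_eq c
  have hcase : transverse i (latticeDir j) = 1 ∨ transverse i (latticeDir j) = -1 := by
    fin_cases i <;> fin_cases j <;> simp [transverse, latticeDir] at h ⊢
  rcases hcase with hv | hv
  · exact ⟨d, funext fun v => by rw [backDiff, Pi.sub_apply, transverse_sub, hv, hd]⟩
  · refine ⟨fun m => - d (m - 1), funext fun v => ?_⟩
    rw [backDiff, Pi.sub_apply, transverse_sub, hv, ← hd]
    beta_reduce
    rw [show transverse i v - -1 - 1 = transverse i v by ring]
    ring

theorem backDiff_comp_transverse_self (i : Fin 3) (c : ℤ → ℝ) :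
    backDiff i (fun v => c (transverse i v)) = 0 := funext fun v => by
  have hv : transverse i (latticeDir i) = 0 := by
    fin_cases i <;> simp [transverse, latticeDir]
  rw [backDiff, Pi.sub_apply, transverse_sub, hv, sub_zero, sub_self, Pi.zero_apply]

/-! ### The pieces fill the common kernel -/

/-- A polynomial of `derivKernel n` that is constant along `dir i` is a piece of a spline whose
coefficients are constant along `dir i`, provided that `n_i ≥ 2`. -/
theorem exists_comp_transverse_of_dirDeriv_eq_zero {n : Fin 3 → ℕ} (hn : ∀ j, 1 ≤ n j) {i : Fin 3}
    (hi : 2 ≤ n i) (T : GridTriangle) {p : MvPolynomial (Fin 2) ℝ} (hp : p ∈ derivKernel n)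
    (hpi : dirDeriv i p = 0) :
    ∃ c : ℤ → ℝ, ∀ x ∈ T.carrier, eval x p = spline n (fun v => c (transverse i v)) x := by
  induction h : ∑ j, n j using Nat.strong_induction_on generalizing n p with
  | _ N ih =>
    by_cases hex : ∃ j, j ≠ i ∧ 2 ≤ n j
    · obtain ⟨j, hji, hj⟩ := hex
      obtain ⟨m, hm, rfl⟩ := exists_eq_add_single hn hj
      have hmi : 2 ≤ m i := by simpa [hji.symm] using hi
      obtain ⟨c, hc⟩ := ih (∑ j, m j) (by rw [← h]; simp [Finset.sum_add_distrib]) hm hmi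
        (dirDeriv_mem_derivKernel hp) (by rw [dirDeriv_comm, hpi, map_zero]) rfl
      obtain ⟨d, hd⟩ := exists_backDiff_comp_transverse hji c
      obtain ⟨q, hq⟩ := exists_polynomial_eq_spline _ hn (fun v => d (transverse i v)) T
      have hqj : dirDeriv j q = dirDeriv j p := dirDeriv_eq_of_spline hm hq (by rwa [hd])
      have hqi : dirDeriv i q = 0 := by
        obtain ⟨m', hm', hmm⟩ := exists_eq_add_single hn hi
        refine dirDeriv_eq_of_spline hm' (c := fun v => d (transverse i v)) (T := T)
          (by rwa [← hmm]) fun x _ => ?_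
        rw [backDiff_comp_transverse_self]
        simp [spline]
      obtain ⟨a, ha⟩ := eq_C_of_dirDeriv_eq_zero hji.symm (p := p - q)
        (by rw [map_sub, hpi, hqi, sub_zero]) (by rw [map_sub, hqj, sub_self])
      refine ⟨fun m => d m + a, fun x hx => ?_⟩
      rw [sub_eq_iff_eq_add.1 ha, map_add, eval_C, hq x hx, add_comm]
      refine ((spline_add _ hn (fun v => d (transverse i v)) (fun _ => a) x).trans ?_).symm
      rw [spline_const _ hn]
    · push Not at hex
      obtain ⟨g1, g2, -⟩ := add_ne_self i
      have e1 : n (i + 1) = 1 := by have := hn (i + 1); have := hex _ g1; omega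
      have e2 : n (i + 2) = 1 := by have := hn (i + 2); have := hex _ g2; omega
      have hpm : p ∈ derivKernel n ⊓ LinearMap.ker (dirDeriv i) := ⟨hp, hpi⟩
      rw [derivKernel_inf_ker (hn i), e1, e2] at hpm
      obtain ⟨r, hr, rfl⟩ := hpm
      have hdeg : r.natDegree ≤ 1 := by
        rw [SetLike.mem_coe, Polynomial.degreeLT_succ_eq_degreeLE, Polynomial.mem_degreeLE] at hr
        exact Polynomial.natDegree_le_of_degree_le hr
      obtain ⟨τ, hτ⟩ := exists_spline_affine n hn
      obtain ⟨α, β, hv, hx⟩ : ∃ α β : ℝ, (∀ v : Fin 2 → ℤ, ((transverse i v : ℤ) : ℝ) =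
          α * v 0 + β * v 1) ∧ ∀ x : Plane, transverse i x = α * x 0 + β * x 1 := by
        refine ⟨![0, 1, 1] i, ![1, 0, -1] i, fun v => ?_, fun x => ?_⟩ <;>
          fin_cases i <;> simp [transverse, sub_eq_add_neg]
      refine ⟨fun m => r.coeff 1 * m + (r.coeff 0 + r.coeff 1 * transverse i τ), fun x _ => ?_⟩
      have := hτ (r.coeff 1 * α) (r.coeff 1 * β) (r.coeff 0 + r.coeff 1 * transverse i τ) x
      have he : (fun v : Fin 2 → ℤ => r.coeff 1 * ((transverse i v : ℤ) : ℝ) +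
          (r.coeff 0 + r.coeff 1 * transverse i τ)) = fun v => r.coeff 1 * α * v 0 +
          r.coeff 1 * β * v 1 + (r.coeff 0 + r.coeff 1 * transverse i τ) := funext fun v => by
        rw [hv]; ring
      rw [he, this, AlgHom.toLinearMap_apply, eval_ridge, hx x, hx τ]
      conv_lhs => rw [Polynomial.eq_X_add_C_of_natDegree_le_one hdeg]
      simp only [Polynomial.eval_add, Polynomial.eval_mul, Polynomial.eval_C, Polynomial.eval_X]
      ring

theorem derivKernel_one_le_polySpace (T : GridTriangle) : derivKernel 1 ≤ polySpace 1 T := by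
  intro p hp
  have h : ∀ {j k : Fin 3}, j ≠ k → dirDeriv j (dirDeriv k p) = 0 := fun hjk => by
    simpa using pow_dirDeriv_eq_zero_of_mem hp hjk
  obtain ⟨a, ha⟩ := eq_C_of_dirDeriv_eq_zero (i := 1) (j := 2) (p := dirDeriv 0 p) (by decide)
    (h (by decide)) (h (by decide))
  obtain ⟨b, hb⟩ := eq_C_of_dirDeriv_eq_zero (i := 0) (j := 2) (p := dirDeriv 1 p) (by decide)
    (h (by decide)) (h (by decide))
  obtain ⟨k, hk⟩ := eq_C_of_dirDeriv_eq_zero (i := 0) (j := 1) (p := p - affinePoly 0 a b)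
    (by decide)
    (by rw [map_sub, ha]; simp [affinePoly, dirDeriv])
    (by rw [map_sub, hb]; simp [affinePoly, dirDeriv])
  obtain ⟨τ, hτ⟩ := exists_spline_affine 1 fun _ => le_rfl
  -- The constant term makes up for the shift `τ`.
  refine (mem_polySpace (n := 1) fun _ => le_rfl).2
    ⟨fun v => a * v 0 + b * v 1 + (k + a * τ 0 + b * τ 1), fun x _ => ?_⟩
  rw [hτ, sub_eq_iff_eq_add.1 hk, map_add, eval_affinePoly, eval_C]
  ring

/-- The derivative along `dir i` maps onto the pieces with one convolution step less. -/
theorem exists_dirDeriv_eq {n : Fin 3 → ℕ} (hn : ∀ j, 1 ≤ n j) (i : Fin 3) {T : GridTriangle}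
    {p : MvPolynomial (Fin 2) ℝ} (hp : p ∈ polySpace n T) :
    ∃ q ∈ polySpace (n + Pi.single i 1) T, dirDeriv i q = p := by
  have hn' : ∀ j, 1 ≤ (n + Pi.single i 1 : Fin 3 → ℕ) j := fun j =>
    (hn j).trans (Nat.le_add_right _ _)
  obtain ⟨c, hc⟩ := (mem_polySpace hn).1 hp
  obtain ⟨d, rfl⟩ := backDiff_surjective i c
  obtain ⟨q, hq⟩ := exists_polynomial_eq_spline _ hn' d T
  exact ⟨q, (mem_polySpace hn').2 ⟨d, hq⟩, dirDeriv_eq_of_spline hn hq hc⟩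

/-- On every triangle, the polynomial pieces of the splines form the space `derivKernel n`. -/
theorem polySpace_eq_derivKernel {n : Fin 3 → ℕ} (hn : ∀ j, 1 ≤ n j) (T : GridTriangle) :
    polySpace n T = derivKernel n := by
  refine le_antisymm (polySpace_le_derivKernel hn T) ?_
  refine multiplicity_induction (P := fun n => derivKernel n ≤ polySpace n T)
    (derivKernel_one_le_polySpace T) (fun n i hn ih p hp => ?_) n hn
  have hn' : ∀ j, 1 ≤ (n + Pi.single i 1 : Fin 3 → ℕ) j := fun j =>
    (hn j).trans (Nat.le_add_right _ _)
  obtain ⟨q, hq, hqp⟩ := exists_dirDeriv_eq hn i (ih (dirDeriv_mem_derivKernel hp))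
  obtain ⟨c, hc⟩ := exists_comp_transverse_of_dirDeriv_eq_zero hn' (i := i)
    (by have := hn i; simp; omega) T (sub_mem hp (polySpace_le_derivKernel hn' T hq))
    (by rw [map_sub, hqp, sub_self])
  rw [← sub_add_cancel p q]
  exact add_mem ((mem_polySpace hn').2 ⟨_, hc⟩) hq

/-! ### The dimension -/

theorem finrank_map_add_finrank_inf_ker {V W : Type*} [AddCommGroup V] [Module ℝ V]
    [AddCommGroup W] [Module ℝ W] (f : V →ₗ[ℝ] W) (S : Submodule ℝ V) [FiniteDimensional ℝ S] :
    Module.finrank ℝ (S.map f) + Module.finrank ℝ ↥(S ⊓ LinearMap.ker f) = Module.finrank ℝ S := by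
  have h := (f.domRestrict S).finrank_range_add_finrank_ker
  rwa [LinearMap.range_domRestrict, LinearMap.ker_domRestrict,
    ← Submodule.finrank_map_subtype_eq, Submodule.map_comap_subtype] at h

theorem finiteDimensional_derivKernel {n : Fin 3 → ℕ} (hn : ∀ j, 1 ≤ n j) :
    FiniteDimensional ℝ (derivKernel n) :=
  Submodule.finiteDimensional_of_le ((polySpace_eq_derivKernel hn ⟨0, false⟩).symm.trans_le
    (polySpace_le_restrictTotalDegree hn ⟨0, false⟩))

theorem finrank_derivKernel {n : Fin 3 → ℕ} (hn : ∀ j, 1 ≤ n j) :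
    Module.finrank ℝ (derivKernel n) = n 0 * n 1 + n 0 * n 2 + n 1 * n 2 := by
  refine multiplicity_induction (P := fun n => Module.finrank ℝ (derivKernel n) =
    n 0 * n 1 + n 0 * n 2 + n 1 * n 2) ?_ (fun n i hn ih => ?_) n hn
  · have := finiteDimensional_derivKernel (n := 1) fun _ => le_rfl
    -- The derivatives along `dir 0` of linear polynomials are the constants.
    have himage : (derivKernel 1).map (dirDeriv 0) = Submodule.span ℝ {1} := by
      ext p
      rw [Submodule.mem_span_singleton]
      constructor
      · rintro ⟨q, hq, rfl⟩
        have h : ∀ j : Fin 3, j ≠ 0 → dirDeriv j (dirDeriv 0 q) = 0 := fun j hj => by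
          simpa using pow_dirDeriv_eq_zero_of_mem hq hj
        obtain ⟨a, ha⟩ := eq_C_of_dirDeriv_eq_zero (i := 1) (j := 2) (by decide)
          (h 1 (by decide)) (h 2 (by decide))
        exact ⟨a, by rw [ha, smul_eq_C_mul, mul_one]⟩
      · rintro ⟨a, rfl⟩
        refine ⟨C a * X 0, mem_derivKernel.2 fun i => ?_, ?_⟩
        · simp [dirDeriv, smul_eq_C_mul]
        · simp [dirDeriv, smul_eq_C_mul]
    rw [← finrank_map_add_finrank_inf_ker (dirDeriv 0), finrank_derivKernel_inf_ker le_rfl, himage,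
      finrank_span_singleton one_ne_zero]
    rfl
  · have hn' : ∀ j, 1 ≤ (n + Pi.single i 1 : Fin 3 → ℕ) j := fun j =>
      (hn j).trans (Nat.le_add_right _ _)
    have := finiteDimensional_derivKernel hn'
    have himage : (derivKernel (n + Pi.single i 1)).map (dirDeriv i) = derivKernel n := by
      refine le_antisymm (Submodule.map_le_iff_le_comap.2 fun p hp =>
        dirDeriv_mem_derivKernel hp) fun p hp => ?_
      rw [← polySpace_eq_derivKernel hn ⟨0, false⟩] at hp
      obtain ⟨q, hq, rfl⟩ := exists_dirDeriv_eq hn i hp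
      exact ⟨q, polySpace_le_derivKernel hn' _ hq, rfl⟩
    rw [← finrank_map_add_finrank_inf_ker (dirDeriv i), finrank_derivKernel_inf_ker (hn' i),
      himage, ih]
    fin_cases i <;> simp <;> ring

end TypeIBoxSpline

end

theorem proposition3p3 (n : Fin 3 → ℕ) (hn : ∀ i, 1 ≤ n i) :
    -- on every triangle, the span of the active translates is a space of polynomials
    -- of total degree at most `n₁ + n₂ + n₃ - 2`
    (∀ T : TypeIBoxSpline.GridTriangle,
      (TypeIBoxSpline.polySpace n T).map (TypeIBoxSpline.polyRestrict T) =
          TypeIBoxSpline.activeSpan n T ∧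
        TypeIBoxSpline.polySpace n T ≤
          MvPolynomial.restrictTotalDegree (Fin 2) ℝ (n 0 + n 1 + n 2 - 2)) ∧
    -- this polynomial space is the same for all triangles
    (∀ T T' : TypeIBoxSpline.GridTriangle,
      TypeIBoxSpline.polySpace n T = TypeIBoxSpline.polySpace n T') ∧
    -- its dimension
    (∀ T : TypeIBoxSpline.GridTriangle,
      Module.finrank ℝ (TypeIBoxSpline.polySpace n T) =
        n 0 * n 1 + n 0 * n 2 + n 1 * n 2) :=
  ⟨fun T => ⟨TypeIBoxSpline.map_polySpace hn T,
      TypeIBoxSpline.polySpace_le_restrictTotalDegree hn T⟩,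
    fun T T' => (TypeIBoxSpline.polySpace_eq_derivKernel hn T).trans
      (TypeIBoxSpline.polySpace_eq_derivKernel hn T').symm,
    fun T => by
      rw [TypeIBoxSpline.polySpace_eq_derivKernel hn T, TypeIBoxSpline.finrank_derivKernel hn]⟩
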